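/- **Setting.** Let $\mathcal S,\mathcal A$ be finite sets with $|\mathcal S|,|\mathcal A|>1$, $\nu_0$ an initial state distribution, $\gamma\in(0,1)$, and $P^0,\dots,P^{K-1}$ ($K\ge 1$) transition laws. Let $h:\mathcal X\to\mathbb R$ be a strictly convex regularizer on a closed convex set $\mathcal X\subseteq\mathbb R^{\mathcal A}$ with $\operatorname{relint}\Delta_{\mathcal A}\subseteq\operatorname{int}\mathcal X$. A policy $\pi$ in the environment $P$ has the occupancy measure $\mu^\pi_P(s,a)=(1-\gamma)\sum_{t\ge 0}\gamma^t\,\mathbb P^{\pi}_{P}(s_t=s,a_t=a)$. For a reward $r\in\mathbb R^{\mathcal S\times\mathcal A}$ put $J(r,\mu)=\langle r,\mu\rangle-\sum_{s,a}\mu(s,a)\,h(\pi^\mu(\cdot|s))$, where $\pi^\mu(a|s)=\mu(s,a)/\sum_{b}\mu(s,b)$ (uniform if the denominator is $0$), and $\mathsf{SubOpt}_P(r,\mu)=\max_{\mu'}J(r,\mu')-J(r,\mu)$, the maximum (supremum) being over all occupancy measures of $P$. Let $\mathcal R=\{r:\|r\|_1\le 1\}$. There are $K$ experts: the $k$-th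 acts in $P^k$ with a policy whose occupancy measure $\mu^{\mathsf E}_{P^k}$ maximizes $J(r^{\mathsf E},\cdot)$ over the occupancy measures of $P^k$, for one common unknown reward $r^{\mathsf E}\in\mathcal R$. The data set $\mathcal D^{\mathsf E}_k$ consists of $N^{\mathsf E}$ trajectories $(s_0,a_0,\dots,s_{H-1},a_{H-1})$ of length $H$ sampled from the $k$-th expert, all of them independent. For a data set $\mathcal D$ of $N$ trajectories of length $H$, $\hat\mu_{\mathcal D}(s,a)=\frac{1-\gamma}{N}\sum_{i<N}\sum_{t<H}\gamma^t\mathbf 1\{s^i_t=s,a^i_t=a\}$. An $(\varepsilon,\delta)$-PAC oracle for $P$ is a randomized map which on every input $r\in\mathcal R$ outputs a policy $\pi$ such that $\mathsf{SubOpt}_P(r,\mu^\pi_P)\le\varepsilon$ with probability at least $1-\delta$. **Algorithm.** Start from any $r_0\in\mathcal R$. For $t=0,\dots,T-2$: for each $k$ call (with fresh independent randomness) an $(\varepsilon_{\mathrm{opt}},\delta_{\mathrm{opt}})$-PAC oracle for $P^k$ on $r_t$ to get $\pi_{k,t}$, and sample a data set $\mathcal D_{k,t}$ of $N$ independent trajectories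 of length $H$ from $\pi_{k,t}$ in $P^k$; put $g_t=\sum_{k}(\hat\mu_{\mathcal D_{k,t}}-\hat\mu_{\mathcal D^{\mathsf E}_k})$ and $r_{t+1}=\Pi_{\mathcal R}(r_t-\alpha g_t)$, where $\Pi_{\mathcal R}$ is the Euclidean projection onto $\mathcal R$ and $\alpha=1/(K\sqrt T)$. Return $\hat r=\frac1T\sum_{t=0}^{T-1}r_t$. **Theorem 3.** There is a universal constant $C>0$ such that in every such setting, for all $\hat\varepsilon>0$ and $\hat\delta\in(0,1)$, if $$N^{\mathsf E}\ge C\,\frac{K\log(|\mathcal S||\mathcal A|/\hat\delta)}{\hat\varepsilon^2},\qquad N\ge C\,\frac{K\log\!\big(K|\mathcal S||\mathcal A|/(\hat\delta\hat\varepsilon)\big)}{\hat\varepsilon^2},\qquad H\ge C\,\frac{\log(16K/\hat\varepsilon)}{\log(1/\gamma)},\qquad T\ge C\,\frac{K^2}{\hat\varepsilon^2},$$ $$\varepsilon_{\mathrm{opt}}\le\frac{\hat\varepsilon}{CK},\qquad \delta_{\mathrm{opt}}\le\frac{\hat\delta\hat\varepsilon^2}{CK^3},$$ then with probability at least $1-\hat\delta$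 the output $\hat r$ satisfies $\mathsf{SubOpt}_{P^k}(\hat r,\mu^{\mathsf E}_{P^k})\le\hat\varepsilon$ for all $k=0,\dots,K-1$. -/

import Mathlib

open MeasureTheory ProbabilityTheory

namespace MultiExpertIRL

/-! ### Regularized Markov decision processes -/

/-- Rewards `r ∈ ℝ^(S × A)`, with the Euclidean norm and the standard dot product. -/
abbrev Reward (S A : Type*) := EuclideanSpace ℝ (S × A)

/-- Stationary Markov policies: `π s a` is the probability of action `a` in state `s`. -/
abbrev Policy (S A : Type*) [Fintype A] := S → stdSimplex ℝ A

/-- Transition laws: `P s a s'` is the probability of moving from `s` to `s'` under `a`. -/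
abbrev TransitionLaw (S A : Type*) [Fintype S] := S → A → stdSimplex ℝ S

/-- The standing assumptions on the regularizer `h : X → ℝ` (its values off `X` are irrelevant):
`X` is a closed convex set whose interior contains the relative interior of the simplex, and `h` is
strictly convex on `X`. (Measurability of a convex function on the simplex is automatic.) -/
structure IsRegularizer {A : Type*} [Fintype A] (X : Set (A → ℝ)) (h : (A → ℝ) → ℝ) : Prop where
  isClosed : IsClosed X
  convex : Convex ℝ X
  subset_interior : intrinsicInterior ℝ (stdSimplex ℝ A) ⊆ interior X
  strictConvexOn : StrictConvexOn ℝ X h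
  measurable : Measurable fun p : stdSimplex ℝ A => h p

/-- Probability of the trajectory `τ = (s₀, a₀, …, s_{H-1}, a_{H-1})` when `s₀ ∼ ν`,
`a_t ∼ π(· | s_t)` and `s_{t+1} ∼ P(· | s_t, a_t)`. -/
noncomputable def trajProb {S A : Type*} [Fintype S] [Fintype A]
    (P : TransitionLaw S A) (π : Policy S A) :
    (H : ℕ) → stdSimplex ℝ S → (Fin H → S × A) → ℝ
  | 0, _, _ => 1
  | H + 1, ν, τ =>
      ν (τ 0).1 * π (τ 0).1 (τ 0).2 * trajProb P π H (P (τ 0).1 (τ 0).2) (Fin.tail τ)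

/-- The probability that `(s_t, a_t) = x`, a marginal of the law of trajectories. -/
noncomputable def visitProb {S A : Type*} [Fintype S] [Fintype A] [DecidableEq S] [DecidableEq A]
    (P : TransitionLaw S A) (ν₀ : stdSimplex ℝ S) (π : Policy S A) (t : ℕ) (x : S × A) : ℝ :=
  ∑ τ : Fin (t + 1) → S × A, if τ (Fin.last t) = x then trajProb P π (t + 1) ν₀ τ else 0

/-- The discounted occupancy measure `μ^π(s,a) = (1 - γ) ∑_t γ^t ℙ(s_t = s, a_t = a)`. -/
noncomputable def occ {S A : Type*} [Fintype S] [Fintype A] [DecidableEq S] [DecidableEq A]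
    (P : TransitionLaw S A) (ν₀ : stdSimplex ℝ S) (γ : ℝ) (π : Policy S A) (x : S × A) : ℝ :=
  (1 - γ) * ∑' t : ℕ, γ ^ t * visitProb P ν₀ π t x

/-- The set of occupancy measures of all policies. -/
def occSet {S A : Type*} [Fintype S] [Fintype A] [DecidableEq S] [DecidableEq A]
    (P : TransitionLaw S A) (ν₀ : stdSimplex ℝ S) (γ : ℝ) : Set (S × A → ℝ) :=
  Set.range (occ P ν₀ γ)

/-- The policy `π^μ` corresponding to `μ` (uniform in the states without mass). -/
noncomputable def policyOf {S A : Type*} [Fintype A] (μ : S × A → ℝ) (s : S) (a : A) : ℝ :=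
  if 0 < ∑ b, μ (s, b) then μ (s, a) / ∑ b, μ (s, b) else 1 / (Fintype.card A : ℝ)

/-- The regularizer of occupancy measures: `h̄(μ) = 𝔼_{(s,a) ∼ μ} h(π^μ(· | s))`. -/
noncomputable def occReg {S A : Type*} [Fintype S] [Fintype A]
    (h : (A → ℝ) → ℝ) (μ : S × A → ℝ) : ℝ :=
  ∑ x : S × A, μ x * h (policyOf μ x.1)

/-- The regularized objective `J(r, μ) = ⟨r, μ⟩ - h̄(μ)`. -/
noncomputable def objective {S A : Type*} [Fintype S] [Fintype A]
    (h : (A → ℝ) → ℝ) (r : Reward S A) (μ : S × A → ℝ) : ℝ :=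
  ∑ x : S × A, r x * μ x - occReg h μ

/-- `RL_P(r)`: the occupancy measures that maximize `J(r, ·)` over all occupancy measures. -/
def optimalOcc {S A : Type*} [Fintype S] [Fintype A] [DecidableEq S] [DecidableEq A]
    (P : TransitionLaw S A) (ν₀ : stdSimplex ℝ S) (γ : ℝ) (h : (A → ℝ) → ℝ) (r : Reward S A) :
    Set (S × A → ℝ) :=
  {μ | μ ∈ occSet P ν₀ γ ∧ ∀ μ' ∈ occSet P ν₀ γ, objective h r μ' ≤ objective h r μ}

/-- `SubOpt_P(r, μ) = max_{μ'} J(r, μ') - J(r, μ)`, with `μ'` over all occupancy measures. The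
supremum is over a nonempty set, bounded above because a convex `h` is bounded below on the
simplex; it is the maximum whenever that exists. -/
noncomputable def subOpt {S A : Type*} [Fintype S] [Fintype A] [DecidableEq S] [DecidableEq A]
    (P : TransitionLaw S A) (ν₀ : stdSimplex ℝ S) (γ : ℝ) (h : (A → ℝ) → ℝ)
    (r : Reward S A) (μ : S × A → ℝ) : ℝ :=
  sSup (objective h r '' occSet P ν₀ γ) - objective h r μ

/-! ### The reward class and the projection onto it -/

/-- The reward class: the unit ball of the `ℓ₁` norm. -/
def rewardClass (S A : Type*) [Fintype S] [Fintype A] : Set (Reward S A) :=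
  {r | ∑ x, |r x| ≤ 1}

theorem rewardClass_nonempty (S A : Type*) [Fintype S] [Fintype A] :
    (rewardClass S A).Nonempty := ⟨0, by simp [rewardClass]⟩

theorem rewardClass_isClosed (S A : Type*) [Fintype S] [Fintype A] :
    IsClosed (rewardClass S A) :=
  isClosed_le (by fun_prop) continuous_const

theorem rewardClass_convex (S A : Type*) [Fintype S] [Fintype A] :
    Convex ℝ (rewardClass S A) := by
  intro x hx y hy a b ha hb hab
  simp only [rewardClass, Set.mem_ofPred_eq] at hx hy ⊢
  calc ∑ i, |(a • x + b • y) i| ≤ ∑ i, (a * |x i| + b * |y i|) := by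
        refine Finset.sum_le_sum fun i _ => ?_
        refine (abs_add_le _ _).trans ?_
        simp [abs_mul, abs_of_nonneg ha, abs_of_nonneg hb]
    _ = a * ∑ i, |x i| + b * ∑ i, |y i| := by
        rw [Finset.sum_add_distrib, Finset.mul_sum, Finset.mul_sum]
    _ ≤ 1 := by nlinarith

theorem exists_proj {S A : Type*} [Fintype S] [Fintype A] (y : Reward S A) :
    ∃ v ∈ rewardClass S A, ‖y - v‖ = ⨅ w : rewardClass S A, ‖y - w‖ :=
  exists_norm_eq_iInf_of_complete_convex (rewardClass_nonempty S A)
    (rewardClass_isClosed S A).isComplete (rewardClass_convex S A) y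

/-- The orthogonal projection onto the reward class. -/
noncomputable def proj {S A : Type*} [Fintype S] [Fintype A] (y : Reward S A) : Reward S A :=
  (exists_proj y).choose

theorem proj_lipschitz {S A : Type*} [Fintype S] [Fintype A] :
    LipschitzWith 1 (proj : Reward S A → Reward S A) := by
  have key : ∀ y w : Reward S A, w ∈ rewardClass S A → inner ℝ (y - proj y) (w - proj y) ≤ 0 :=
    fun y => (norm_eq_iInf_iff_real_inner_le_zero (rewardClass_convex S A)
      (exists_proj y).choose_spec.1).1 (exists_proj y).choose_spec.2
  refine LipschitzWith.of_dist_le_mul fun x y => ?_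
  have h1 := key x (proj y) (exists_proj y).choose_spec.1
  have h2 := key y (proj x) (exists_proj x).choose_spec.1
  have h3 : ‖proj x - proj y‖ ^ 2 ≤ inner ℝ (x - y) (proj x - proj y) := by
    rw [← real_inner_self_eq_norm_sq]
    simp only [inner_sub_left, inner_sub_right] at h1 h2 ⊢
    have e := real_inner_comm (proj x) (proj y)
    linarith
  have h4 := real_inner_le_norm (x - y) (proj x - proj y)
  rw [dist_eq_norm, dist_eq_norm, NNReal.coe_one, one_mul]
  by_contra hlt
  push Not at hlt
  have : 0 ≤ ‖x - y‖ := norm_nonneg _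
  nlinarith

/-! ### Data sets and rollouts -/

/-- `K` data sets of `N` trajectories of length `H` each. -/
def Dataset (K N H : ℕ) (S A : Type*) := Fin K → Fin N → Fin H → S × A

instance (K N H : ℕ) (S A : Type*) : MeasurableSpace (Dataset K N H S A) := ⊤

instance (K N H : ℕ) (S A : Type*) : DiscreteMeasurableSpace (Dataset K N H S A) :=
  ⟨fun _ => trivial⟩

instance (K N H : ℕ) (S A : Type*) [Fintype S] [Fintype A] : Fintype (Dataset K N H S A) :=
  inferInstanceAs (Fintype (Fin K → Fin N → Fin H → S × A))

/-- The law of `K` data sets in which all the trajectories are independent and those of the `k`-th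
data set are sampled from the policy `π k` under the transition law `P k`. -/
noncomputable def datasetLaw {K : ℕ} {S A : Type*} [Fintype S] [Fintype A] (N H : ℕ)
    (P : Fin K → TransitionLaw S A) (ν₀ : stdSimplex ℝ S) (π : Fin K → Policy S A) :
    Measure (Dataset K N H S A) :=
  ∑ D : Dataset K N H S A,
    ENNReal.ofReal (∏ k, ∏ i, trajProb (P k) (π k) H ν₀ (D k i)) • Measure.dirac D

theorem trajProb_nonneg {S A : Type*} [Fintype S] [Fintype A]
    (P : TransitionLaw S A) (π : Policy S A) (H : ℕ) (ν : stdSimplex ℝ S) (τ : Fin H → S × A) :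
    0 ≤ trajProb P π H ν τ := by
  induction H generalizing ν with
  | zero => simp [trajProb]
  | succ n ih =>
    exact mul_nonneg (mul_nonneg (ν.2.1 _) ((π _).2.1 _)) (ih _ _)

theorem sum_trajProb {S A : Type*} [Fintype S] [Fintype A]
    (P : TransitionLaw S A) (π : Policy S A) (H : ℕ) (ν : stdSimplex ℝ S) :
    ∑ τ : Fin H → S × A, trajProb P π H ν τ = 1 := by
  induction H generalizing ν with
  | zero => simp [trajProb]
  | succ n ih =>
    have hπ : ∀ s, ∑ a, π s a = 1 := fun s => (π s).2.2
    have hν : ∑ s, ν s = 1 := ν.2.2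
    have e := (Fin.consEquiv fun _ : Fin (n + 1) => S × A).sum_comp (trajProb P π (n + 1) ν)
    rw [← e, Fintype.sum_prod_type]
    have h1 : ∀ (x : S × A) (y : Fin n → S × A),
        trajProb P π (n + 1) ν (Fin.consEquiv (fun _ : Fin (n + 1) => S × A) (x, y)) =
          ν x.1 * π x.1 x.2 * trajProb P π n (P x.1 x.2) y := fun _ _ => rfl
    simp only [h1, ← Finset.mul_sum, ih, mul_one]
    simp only [Fintype.sum_prod_type, ← Finset.mul_sum, hπ, mul_one, hν]

instance isProbabilityMeasure_datasetLaw {K : ℕ} {S A : Type*} [Fintype S] [Fintype A] (N H : ℕ)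
    (P : Fin K → TransitionLaw S A) (ν₀ : stdSimplex ℝ S) (π : Fin K → Policy S A) :
    IsProbabilityMeasure (datasetLaw N H P ν₀ π) := by
  constructor
  simp only [datasetLaw, Measure.coe_finsetSum, Finset.sum_apply, Measure.smul_apply,
    smul_eq_mul, measure_univ, mul_one]
  have h0 : ∀ D : Dataset K N H S A, 0 ≤ ∏ k, ∏ i, trajProb (P k) (π k) H ν₀ (D k i) :=
    fun D => Finset.prod_nonneg fun k _ => Finset.prod_nonneg fun i _ =>
      trajProb_nonneg _ _ _ _ _
  refine (ENNReal.ofReal_sum_of_nonneg fun D _ => h0 D).symm.trans ?_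
  rw [← ENNReal.ofReal_one]
  congr 1
  have h1 : ∑ D : Fin K → Fin N → Fin H → S × A,
      ∏ k, ∏ i, trajProb (P k) (π k) H ν₀ (D k i) = 1 := by
    rw [← Fintype.prod_sum fun k (d : Fin N → Fin H → S × A) =>
      ∏ i, trajProb (P k) (π k) H ν₀ (d i)]
    refine Finset.prod_eq_one fun k _ => ?_
    rw [← Fintype.prod_sum fun (_ : Fin N) τ => trajProb (P k) (π k) H ν₀ τ]
    exact Finset.prod_eq_one fun i _ => sum_trajProb _ _ _ _
  rw [← h1]
  exact Fintype.sum_equiv (Equiv.refl _) _ _ fun _ => rfl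

/-- The rollouts as a Markov kernel from the policies to the data sets. -/
noncomputable def rollout {K : ℕ} {S A : Type*} [Fintype S] [Fintype A] (N H : ℕ)
    (P : Fin K → TransitionLaw S A) (ν₀ : stdSimplex ℝ S) :
    Kernel (Fin K → Policy S A) (Dataset K N H S A) where
  toFun := datasetLaw N H P ν₀
  measurable' := by
    have ht : ∀ (k : Fin K) (n : ℕ) (ν : stdSimplex ℝ S) (τ : Fin n → S × A),
        Measurable fun π : Fin K → Policy S A => trajProb (P k) (π k) n ν τ := by
      intro k n
      induction n with
      | zero => intro ν τ; simp only [trajProb]; fun_prop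
      | succ n ih =>
        intro ν τ
        simp only [trajProb]
        refine Measurable.mul (Measurable.mul measurable_const ?_) (ih _ _)
        exact (measurable_pi_apply _).comp (measurable_subtype_coe.comp
          ((measurable_pi_apply _).comp (measurable_pi_apply k)))
    refine Measure.measurable_of_measurable_coe _ fun s _ => ?_
    simp only [datasetLaw, Measure.coe_finsetSum, Finset.sum_apply, Measure.smul_apply,
      smul_eq_mul]
    refine Finset.measurable_sum _ fun D _ => Measurable.mul_const ?_ _
    refine ENNReal.measurable_ofReal.comp ?_
    exact Finset.measurable_prod _ fun k _ => Finset.measurable_prod _ fun i _ => ht k H ν₀ _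

instance isMarkovKernel_rollout {K : ℕ} {S A : Type*} [Fintype S] [Fintype A] (N H : ℕ)
    (P : Fin K → TransitionLaw S A) (ν₀ : stdSimplex ℝ S) : IsMarkovKernel (rollout N H P ν₀) :=
  ⟨fun π => isProbabilityMeasure_datasetLaw N H P ν₀ π⟩

/-- The empirical occupancy measure of the data set `D`. -/
noncomputable def empOcc {N H : ℕ} {S A : Type*} [DecidableEq S] [DecidableEq A]
    (γ : ℝ) (D : Fin N → Fin H → S × A) (x : S × A) : ℝ :=
  (1 - γ) / N * ∑ i, ∑ t : Fin H, γ ^ (t : ℕ) * if D i t = x then 1 else 0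

/-! ### The algorithm -/

/-- An `(ε, δ)`-PAC algorithm for the forward problem under the transition law `P`. It is
randomized: on the input `r` it outputs a policy with the law `oracle r`, and with probability at
least `1 - δ` this policy is `ε`-optimal for `r`. Only queries in the reward class matter. -/
def IsPACOracle {S A : Type*} [Fintype S] [Fintype A] [DecidableEq S] [DecidableEq A]
    (P : TransitionLaw S A) (ν₀ : stdSimplex ℝ S) (γ : ℝ) (h : (A → ℝ) → ℝ)
    (ε δ : ℝ) (oracle : Kernel (Reward S A) (Policy S A)) : Prop :=
  ∀ r ∈ rewardClass S A,
    1 - δ ≤ (oracle r).real {π | subOpt P ν₀ γ h r (occ P ν₀ γ π) ≤ ε}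

/-- One call of each of the `K` oracles, with independent randomness. -/
noncomputable def callOracles {K : ℕ} {S A : Type*} [Fintype S] [Fintype A]
    (oracle : Fin K → Kernel (Reward S A) (Policy S A)) [∀ k, IsMarkovKernel (oracle k)] :
    Kernel (Reward S A) (Fin K → Policy S A) where
  toFun r := Measure.pi fun k => oracle k r
  measurable' := by
    refine Measurable.measure_of_isPiSystem_of_isProbabilityMeasure
      generateFrom_pi.symm isPiSystem_pi ?_
    rintro _ ⟨s, hs, rfl⟩
    simp only [Measure.pi_pi]
    exact Finset.measurable_prod _ fun k _ => Kernel.measurable_coe _ (hs k (Set.mem_univ k))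

instance isMarkovKernel_callOracles {K : ℕ} {S A : Type*} [Fintype S] [Fintype A]
    (oracle : Fin K → Kernel (Reward S A) (Policy S A)) [∀ k, IsMarkovKernel (oracle k)] :
    IsMarkovKernel (callOracles oracle) :=
  ⟨fun r => inferInstanceAs (IsProbabilityMeasure (Measure.pi fun k => oracle k r))⟩

/-- `g = ∑_k (μ̂_{D_k} - μ̂_{Dᴱ_k})`. -/
noncomputable def gradient {K N H NE HE : ℕ} {S A : Type*} [DecidableEq S] [DecidableEq A]
    (γ : ℝ) (D : Dataset K N H S A) (DE : Dataset K NE HE S A) : Reward S A :=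
  WithLp.toLp 2 fun x => ∑ k, (empOcc γ (D k) x - empOcc γ (DE k) x)

/-- The update of the state `(r_t, r_0 + … + r_t)` by the reward step, given the rollouts `D`. -/
noncomputable def update {K N H NE HE : ℕ} {S A : Type*} [Fintype S] [Fintype A]
    [DecidableEq S] [DecidableEq A] (γ α : ℝ) (DE : Dataset K NE HE S A)
    (x : (Reward S A × Reward S A) × Dataset K N H S A) : Reward S A × Reward S A :=
  (proj (x.1.1 - α • gradient γ x.2 DE), x.1.2 + proj (x.1.1 - α • gradient γ x.2 DE))

theorem measurable_update {K N H NE HE : ℕ} {S A : Type*} [Fintype S] [Fintype A]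
    [DecidableEq S] [DecidableEq A] (γ α : ℝ) (DE : Dataset K NE HE S A) :
    Measurable (update (N := N) (H := H) γ α DE) := by
  refine measurable_from_prod_countable_left fun D => ?_
  have h1 : Measurable fun x : Reward S A × Reward S A => proj (x.1 - α • gradient γ D DE) :=
    proj_lipschitz.continuous.measurable.comp (measurable_fst.sub_const _)
  exact h1.prodMk (measurable_snd.add h1)

/-- One iteration: from `(r_t, r_0 + … + r_t)` to `(r_{t+1}, r_0 + … + r_{t+1})`. First
`π_{k,t}` is obtained by calling the oracles on `r_t`, then the rollouts are sampled from the
policies `π_{k,t}`, then the reward step is made. -/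
noncomputable def iteration {K NE HE : ℕ} {S A : Type*} [Fintype S] [Fintype A]
    [DecidableEq S] [DecidableEq A] (N H : ℕ)
    (P : Fin K → TransitionLaw S A) (ν₀ : stdSimplex ℝ S) (γ : ℝ)
    (oracle : Fin K → Kernel (Reward S A) (Policy S A)) [∀ k, IsMarkovKernel (oracle k)]
    (α : ℝ) (DE : Dataset K NE HE S A) :
    Kernel (Reward S A × Reward S A) (Reward S A × Reward S A) :=
  (Kernel.id ×ₖ ((rollout N H P ν₀ ∘ₖ callOracles oracle).comap Prod.fst measurable_fst)).map
    (update γ α DE)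

instance isMarkovKernel_iteration {K NE HE : ℕ} {S A : Type*} [Fintype S] [Fintype A]
    [DecidableEq S] [DecidableEq A] (N H : ℕ)
    (P : Fin K → TransitionLaw S A) (ν₀ : stdSimplex ℝ S) (γ : ℝ)
    (oracle : Fin K → Kernel (Reward S A) (Policy S A)) [∀ k, IsMarkovKernel (oracle k)]
    (α : ℝ) (DE : Dataset K NE HE S A) :
    IsMarkovKernel (iteration N H P ν₀ γ oracle α DE) :=
  Kernel.IsMarkovKernel.map _ (measurable_update γ α DE)

/-- The law of `(r_t, r_0 + … + r_t)` when the algorithm is run on the expert data `DE`. -/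
noncomputable def runLaw {K NE HE : ℕ} {S A : Type*} [Fintype S] [Fintype A]
    [DecidableEq S] [DecidableEq A] (N H : ℕ)
    (P : Fin K → TransitionLaw S A) (ν₀ : stdSimplex ℝ S) (γ : ℝ)
    (oracle : Fin K → Kernel (Reward S A) (Policy S A)) [∀ k, IsMarkovKernel (oracle k)]
    (α : ℝ) (r₀ : Reward S A) (DE : Dataset K NE HE S A) :
    ℕ → Measure (Reward S A × Reward S A)
  | 0 => Measure.dirac (r₀, r₀)
  | t + 1 => (runLaw N H P ν₀ γ oracle α r₀ DE t).bind (iteration N H P ν₀ γ oracle α DE)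

/-- The law of the output `r̂ = (r_0 + … + r_{T-1}) / T` of the algorithm, which starts from `r₀`
and makes the iterations `0, …, T - 2`, on random expert data: `NE` independent trajectories of
length `HE` from each of the expert policies `πE k`. -/
noncomputable def outputLaw {K : ℕ} {S A : Type*} [Fintype S] [Fintype A]
    [DecidableEq S] [DecidableEq A]
    (P : Fin K → TransitionLaw S A) (ν₀ : stdSimplex ℝ S) (γ : ℝ)
    (πE : Fin K → Policy S A) (NE HE : ℕ)
    (oracle : Fin K → Kernel (Reward S A) (Policy S A)) [∀ k, IsMarkovKernel (oracle k)]
    (N H T : ℕ) (α : ℝ) (r₀ : Reward S A) : Measure (Reward S A) :=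
  (datasetLaw NE HE P ν₀ πE).bind fun DE =>
    (runLaw N H P ν₀ γ oracle α r₀ DE (T - 1)).map fun x => (T : ℝ)⁻¹ • x.2

theorem isProbabilityMeasure_runLaw {K NE HE : ℕ} {S A : Type*} [Fintype S] [Fintype A]
    [DecidableEq S] [DecidableEq A] (N H : ℕ)
    (P : Fin K → TransitionLaw S A) (ν₀ : stdSimplex ℝ S) (γ : ℝ)
    (oracle : Fin K → Kernel (Reward S A) (Policy S A)) [∀ k, IsMarkovKernel (oracle k)]
    (α : ℝ) (r₀ : Reward S A) (DE : Dataset K NE HE S A) (t : ℕ) :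
    IsProbabilityMeasure (runLaw N H P ν₀ γ oracle α r₀ DE t) := by
  induction t with
  | zero => exact inferInstanceAs (IsProbabilityMeasure (Measure.dirac (r₀, r₀)))
  | succ t ih => rw [runLaw]; infer_instance

theorem isProbabilityMeasure_outputLaw {K : ℕ} {S A : Type*} [Fintype S] [Fintype A]
    [DecidableEq S] [DecidableEq A]
    (P : Fin K → TransitionLaw S A) (ν₀ : stdSimplex ℝ S) (γ : ℝ)
    (πE : Fin K → Policy S A) (NE HE : ℕ)
    (oracle : Fin K → Kernel (Reward S A) (Policy S A)) [∀ k, IsMarkovKernel (oracle k)]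
    (N H T : ℕ) (α : ℝ) (r₀ : Reward S A) :
    IsProbabilityMeasure (outputLaw P ν₀ γ πE NE HE oracle N H T α r₀) := by
  refine isProbabilityMeasure_bind (Measurable.of_discrete).aemeasurable (.of_forall fun DE => ?_)
  have := isProbabilityMeasure_runLaw N H P ν₀ γ oracle α r₀ DE (T - 1)
  have hm : Measurable fun x : Reward S A × Reward S A => (T : ℝ)⁻¹ • x.2 := by fun_prop
  exact Measure.isProbabilityMeasure_map hm.aemeasurable

end MultiExpertIRL

set_option linter.unusedSectionVars false

namespace MultiExpertIRL

/-! ### Hoeffding's inequality for finitely supported laws -/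

theorem sum_mul_exp_le {Ω : Type*} [Fintype Ω] (w f : Ω → ℝ) (hw : ∀ i, 0 ≤ w i)
    (hw1 : ∑ i, w i = 1) (hf0 : ∀ i, 0 ≤ f i) (hf1 : ∀ i, f i ≤ 1) (c : ℝ) :
    ∑ i, w i * Real.exp (c * (f i - ∑ j, w j * f j)) ≤ Real.exp (c ^ 2 / 8) := by
  let _ : MeasurableSpace Ω := ⊤
  let μ : Measure Ω := ∑ i, ENNReal.ofReal (w i) • Measure.dirac i
  have hint : ∀ g : Ω → ℝ, ∫ x, g x ∂μ = ∑ i, w i * g i := by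
    intro g
    rw [integral_finsetSum_measure fun i _ => (integrable_dirac (by simp)).smul_measure (by simp)]
    refine Finset.sum_congr rfl fun i _ => ?_
    rw [integral_smul_measure, integral_dirac, ENNReal.toReal_ofReal (hw i), smul_eq_mul]
  have hμ : IsProbabilityMeasure μ := by
    constructor
    simp only [μ, Measure.coe_finsetSum, Finset.sum_apply, Measure.smul_apply, smul_eq_mul,
      measure_univ, mul_one]
    rw [← ENNReal.ofReal_sum_of_nonneg fun i _ => hw i, hw1, ENNReal.ofReal_one]
  -- Hoeffding's lemma on an interval of length 1: variance proxy `1/4`, hence the exponent `c ^ 2 /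
  -- 8`.
  have h := (hasSubgaussianMGF_of_mem_Icc (μ := μ) (X := f) (a := 0) (b := 1)
    (Measurable.of_discrete).aemeasurable (.of_forall fun i => ⟨hf0 i, hf1 i⟩)).mgf_le c
  rw [mgf, hint] at h
  simp only [hint] at h
  refine h.trans (Real.exp_le_exp.2 ?_)
  norm_num
  linarith

/-- By independence the exponential moment factorizes over the `K N` samples, and Hoeffding's lemma
bounds each factor. -/
theorem sum_prod_mul_exp_le {Ω : Type*} [Fintype Ω] [DecidableEq Ω] {K N : ℕ}
    (w : Fin K → Ω → ℝ) (f : Ω → ℝ)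
    (hw : ∀ k i, 0 ≤ w k i) (hw1 : ∀ k, ∑ i, w k i = 1) (hf0 : ∀ i, 0 ≤ f i)
    (hf1 : ∀ i, f i ≤ 1) (c : ℝ) :
    ∑ D : Fin K → Fin N → Ω, (∏ k, ∏ i, w k (D k i)) *
      Real.exp (c * ∑ k, ∑ i, (f (D k i) - ∑ j, w k j * f j)) ≤
        Real.exp (K * N * (c ^ 2 / 8)) := by
  have h1 : ∀ D : Fin K → Fin N → Ω, (∏ k, ∏ i, w k (D k i)) *
      Real.exp (c * ∑ k, ∑ i, (f (D k i) - ∑ j, w k j * f j)) =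
      ∏ k, ∏ i, (w k (D k i) * Real.exp (c * (f (D k i) - ∑ j, w k j * f j))) := by
    intro D
    simp only [Finset.mul_sum, Real.exp_sum, Finset.prod_mul_distrib]
  simp only [h1]
  rw [← Fintype.prod_sum fun k (d : Fin N → Ω) =>
    ∏ i, (w k (d i) * Real.exp (c * (f (d i) - ∑ j, w k j * f j)))]
  have h2 : ∀ k, ∑ d : Fin N → Ω, ∏ i, (w k (d i) * Real.exp (c * (f (d i) - ∑ j, w k j * f j)))
      ≤ Real.exp (N * (c ^ 2 / 8)) := by
    intro k
    rw [← Fintype.prod_sum fun (_ : Fin N) τ =>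
      w k τ * Real.exp (c * (f τ - ∑ j, w k j * f j))]
    rw [Finset.prod_const, Finset.card_univ, Fintype.card_fin, Real.exp_nat_mul]
    refine pow_le_pow_left₀ (Finset.sum_nonneg fun i _ => mul_nonneg (hw k i) (Real.exp_nonneg _))
      (sum_mul_exp_le _ _ (hw k) (hw1 k) hf0 hf1 c) _
  refine (Finset.prod_le_prod (fun k _ => Finset.sum_nonneg fun d _ => Finset.prod_nonneg
    fun i _ => mul_nonneg (hw k _) (Real.exp_nonneg _)) fun k _ => h2 k).trans ?_
  rw [Finset.prod_const, Finset.card_univ, Fintype.card_fin, mul_assoc, Real.exp_nat_mul _ K]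

open scoped Classical in
/-- **Hoeffding's inequality** for `K` groups of `N` independent samples. -/
theorem sum_prod_deviation_le {Ω : Type*} [Fintype Ω] {K N : ℕ} (hK : 0 < K)
    (w : Fin K → Ω → ℝ) (f : Ω → ℝ)
    (hw : ∀ k i, 0 ≤ w k i) (hw1 : ∀ k, ∑ i, w k i = 1) (hf0 : ∀ i, 0 ≤ f i)
    (hf1 : ∀ i, f i ≤ 1) (η : ℝ) (hη : 0 ≤ η) :
    ∑ D : Fin K → Fin N → Ω, (if η * N ≤ |∑ k, ∑ i, (f (D k i) - ∑ j, w k j * f j)| then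
        ∏ k, ∏ i, w k (D k i) else 0) ≤
        2 * Real.exp (-(2 * η ^ 2 * N / K)) := by
  have hK' : (0 : ℝ) < K := by exact_mod_cast hK
  set c : ℝ := 4 * η / K with hc
  have hc0 : 0 ≤ c := by positivity
  have hle := sum_prod_mul_exp_le (N := N) w f hw hw1 hf0 hf1
  have e : ∀ c' : ℝ, c' ^ 2 = c ^ 2 → Real.exp (-(c * (η * N))) *
      Real.exp (K * N * (c' ^ 2 / 8)) = Real.exp (-(2 * η ^ 2 * N / K)) := by
    intro c' h
    rw [← Real.exp_add, h, hc]
    congr 1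
    field_simp
    ring
  -- The indicator of the two-sided deviation is at most the sum of the two exponential tilts `exp
  -- (±c z - c η N)`, whence the factor 2.
  have hb : ∀ D : Fin K → Fin N → Ω,
      (if η * N ≤ |∑ k, ∑ i, (f (D k i) - ∑ j, w k j * f j)| then
        ∏ k, ∏ i, w k (D k i) else 0) ≤
      Real.exp (-(c * (η * N))) * ((∏ k, ∏ i, w k (D k i)) *
        Real.exp (c * ∑ k, ∑ i, (f (D k i) - ∑ j, w k j * f j))) +
      Real.exp (-(c * (η * N))) * ((∏ k, ∏ i, w k (D k i)) *
        Real.exp (-c * ∑ k, ∑ i, (f (D k i) - ∑ j, w k j * f j))) := by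
    intro D
    set z := ∑ k, ∑ i, (f (D k i) - ∑ j, w k j * f j)
    have hp : 0 ≤ ∏ k, ∏ i, w k (D k i) :=
      Finset.prod_nonneg fun k _ => Finset.prod_nonneg fun i _ => hw _ _
    set p := ∏ k, ∏ i, w k (D k i)
    have e1 : ∀ c', Real.exp (-(c * (η * N))) * (p * Real.exp (c' * z)) =
        p * Real.exp (c' * z - c * (η * N)) := by
      intro c'
      rw [sub_eq_add_neg, Real.exp_add]; ring
    rw [e1, e1]
    have n1 : 0 ≤ p * Real.exp (c * z - c * (η * N)) := by positivity
    have n2 : 0 ≤ p * Real.exp (-c * z - c * (η * N)) := by positivity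
    split_ifs with h
    · rcases le_abs.1 h with h | h
      · have : 1 ≤ Real.exp (c * z - c * (η * N)) := Real.one_le_exp (by nlinarith)
        nlinarith
      · have : 1 ≤ Real.exp (-c * z - c * (η * N)) := Real.one_le_exp (by nlinarith)
        nlinarith
    · linarith
  refine (Finset.sum_le_sum fun D _ => hb D).trans ?_
  rw [Finset.sum_add_distrib, ← Finset.mul_sum, ← Finset.mul_sum]
  have l1 := mul_le_mul_of_nonneg_left (hle c) (Real.exp_nonneg (-(c * (η * N))))
  have l2 := mul_le_mul_of_nonneg_left (hle (-c)) (Real.exp_nonneg (-(c * (η * N))))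
  rw [e c rfl] at l1
  rw [e (-c) (by ring)] at l2
  linarith

theorem sum_eq_sum_sum_cons {Ω : Type*} [Fintype Ω] (H : ℕ) (F : (Fin (H + 1) → Ω) → ℝ) :
    ∑ τ, F τ = ∑ y : Ω, ∑ τ : Fin H → Ω, F (Fin.cons y τ) := by
  rw [← (Fin.consEquiv fun _ : Fin (H + 1) => Ω).sum_comp F, Fintype.sum_prod_type]
  rfl

/-! ### Marginals of trajectories and occupancy measures -/

section occupancy

variable {S A : Type*} [Fintype S] [Fintype A] [DecidableEq S] [DecidableEq A]

/-- The probability that the `t`-th step of a trajectory of length `H` is `x`. -/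
noncomputable def marginal (P : TransitionLaw S A) (π : Policy S A) (H : ℕ) (ν : stdSimplex ℝ S)
    (t : Fin H) (x : S × A) : ℝ :=
  ∑ τ : Fin H → S × A, if τ t = x then trajProb P π H ν τ else 0

theorem marginal_zero (P : TransitionLaw S A) (π : Policy S A) (H : ℕ) (ν : stdSimplex ℝ S)
    (x : S × A) : marginal P π (H + 1) ν 0 x = ν x.1 * π x.1 x.2 := by
  rw [marginal, sum_eq_sum_sum_cons]
  have : ∀ y : S × A, ∑ τ : Fin H → S × A,
      (if (Fin.cons y τ : Fin (H + 1) → S × A) 0 = x then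
        trajProb P π (H + 1) ν (Fin.cons y τ) else 0) =
      if y = x then ν y.1 * π y.1 y.2 else 0 := by
    intro y
    simp only [Fin.cons_zero, trajProb, Fin.tail_cons]
    split_ifs
    · rw [← Finset.mul_sum, sum_trajProb, mul_one]
    · simp
  simp only [this]
  simp

theorem marginal_succ (P : TransitionLaw S A) (π : Policy S A) (H : ℕ) (ν : stdSimplex ℝ S)
    (t : Fin H) (x : S × A) : marginal P π (H + 1) ν t.succ x =
      ∑ y : S × A, ν y.1 * π y.1 y.2 * marginal P π H (P y.1 y.2) t x := by
  rw [marginal, sum_eq_sum_sum_cons]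
  refine Finset.sum_congr rfl fun y _ => ?_
  rw [marginal, Finset.mul_sum]
  refine Finset.sum_congr rfl fun τ _ => ?_
  simp only [Fin.cons_succ, trajProb, Fin.tail_cons, Fin.cons_zero]
  split_ifs <;> simp

/-- The steps after time `t` sum out to 1, so the marginal does not see the horizon. As `trajProb`
recurses on the first step, the induction peels off the beginning of the trajectory. -/
theorem marginal_congr (P : TransitionLaw S A) (π : Policy S A) (t : ℕ) :
    ∀ (H H' : ℕ) (h : t < H) (h' : t < H') (ν : stdSimplex ℝ S) (x : S × A),
      marginal P π H ν ⟨t, h⟩ x = marginal P π H' ν ⟨t, h'⟩ x := by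
  induction t with
  | zero =>
    intro H H' h h' ν x
    obtain ⟨H, rfl⟩ := Nat.exists_eq_succ_of_ne_zero h.ne'
    obtain ⟨H', rfl⟩ := Nat.exists_eq_succ_of_ne_zero h'.ne'
    exact (marginal_zero P π H ν x).trans (marginal_zero P π H' ν x).symm
  | succ t ih =>
    intro H H' h h' ν x
    obtain ⟨H, rfl⟩ := Nat.exists_eq_succ_of_ne_zero (by omega : H ≠ 0)
    obtain ⟨H', rfl⟩ := Nat.exists_eq_succ_of_ne_zero (by omega : H' ≠ 0)
    have e := marginal_succ P π H ν ⟨t, by omega⟩ x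
    have e' := marginal_succ P π H' ν ⟨t, by omega⟩ x
    refine e.trans (Eq.trans ?_ e'.symm)
    exact Finset.sum_congr rfl fun y _ => by rw [ih H H']

theorem marginal_eq_visitProb (P : TransitionLaw S A) (π : Policy S A) (H : ℕ)
    (ν : stdSimplex ℝ S) (t : Fin H) (x : S × A) :
    marginal P π H ν t x = visitProb P ν π t x :=
  marginal_congr P π t H (t + 1) t.2 (Nat.lt_succ_self _) ν x

theorem visitProb_nonneg (P : TransitionLaw S A) (ν : stdSimplex ℝ S) (π : Policy S A) (t : ℕ)
    (x : S × A) : 0 ≤ visitProb P ν π t x :=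
  Finset.sum_nonneg fun τ _ => by split_ifs <;> simp [trajProb_nonneg]

theorem visitProb_le_one (P : TransitionLaw S A) (ν : stdSimplex ℝ S) (π : Policy S A) (t : ℕ)
    (x : S × A) : visitProb P ν π t x ≤ 1 := by
  rw [← sum_trajProb P π (t + 1) ν]
  exact Finset.sum_le_sum fun τ _ => by split_ifs <;> simp [trajProb_nonneg]

theorem summable_visitProb (P : TransitionLaw S A) (ν : stdSimplex ℝ S) {γ : ℝ} (hγ : 0 < γ)
    (hγ1 : γ < 1) (π : Policy S A) (x : S × A) :
    Summable fun t : ℕ => γ ^ t * visitProb P ν π t x :=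
  Summable.of_nonneg_of_le (fun t => mul_nonneg (by positivity) (visitProb_nonneg _ _ _ _ _))
    (fun t => mul_le_of_le_one_right (by positivity) (visitProb_le_one _ _ _ _ _))
    (summable_geometric_of_lt_one hγ.le hγ1)

theorem occ_nonneg (P : TransitionLaw S A) (ν : stdSimplex ℝ S) {γ : ℝ} (hγ : 0 < γ)
    (hγ1 : γ < 1) (π : Policy S A) (x : S × A) : 0 ≤ occ P ν γ π x :=
  mul_nonneg (by linarith)
    (tsum_nonneg fun t => mul_nonneg (by positivity) (visitProb_nonneg _ _ _ _ _))

/-- The occupancy measure of the first `H` steps. -/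
noncomputable def truncOcc (P : TransitionLaw S A) (ν : stdSimplex ℝ S) (γ : ℝ) (H : ℕ)
    (π : Policy S A) (x : S × A) : ℝ :=
  (1 - γ) * ∑ t ∈ Finset.range H, γ ^ t * visitProb P ν π t x

theorem truncOcc_le_occ (P : TransitionLaw S A) (ν : stdSimplex ℝ S) {γ : ℝ} (hγ : 0 < γ)
    (hγ1 : γ < 1) (H : ℕ) (π : Policy S A) (x : S × A) :
    truncOcc P ν γ H π x ≤ occ P ν γ π x :=
  mul_le_mul_of_nonneg_left ((summable_visitProb P ν hγ hγ1 π x).sum_le_tsum _ fun t _ =>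
    mul_nonneg (by positivity) (visitProb_nonneg _ _ _ _ _)) (by linarith)

/-- The discarded tail has weight `(1 - γ) ∑_{t ≥ H} γ^t = γ^H`. -/
theorem occ_le_truncOcc_add (P : TransitionLaw S A) (ν : stdSimplex ℝ S) {γ : ℝ} (hγ : 0 < γ)
    (hγ1 : γ < 1) (H : ℕ) (π : Policy S A) (x : S × A) :
    occ P ν γ π x ≤ truncOcc P ν γ H π x + γ ^ H := by
  have hs := summable_visitProb P ν hγ hγ1 π x
  have hg := summable_geometric_of_lt_one hγ.le hγ1
  have h1 : ∑' t : ℕ, γ ^ (t + H) * visitProb P ν π (t + H) x ≤ ∑' t : ℕ, γ ^ t * γ ^ H := by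
    have hs' : Summable fun t : ℕ => γ ^ (t + H) * visitProb P ν π (t + H) x :=
      (summable_nat_add_iff (f := fun t : ℕ => γ ^ t * visitProb P ν π t x) H).2 hs
    refine Summable.tsum_le_tsum (fun t => ?_) hs' (hg.mul_right (γ ^ H))
    rw [pow_add]
    exact mul_le_of_le_one_right (by positivity) (visitProb_le_one _ _ _ _ _)
  rw [tsum_mul_right, tsum_geometric_of_lt_one hγ.le hγ1] at h1
  have h2 : 0 < 1 - γ := by linarith
  have h3 := mul_le_mul_of_nonneg_left h1 h2.le
  have h4 : (1 - γ) * ((1 - γ)⁻¹ * γ ^ H) = γ ^ H := by field_simp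
  rw [occ, truncOcc, ← hs.sum_add_tsum_nat_add H, mul_add]
  linarith

theorem occ_le_one (P : TransitionLaw S A) (ν : stdSimplex ℝ S) {γ : ℝ} (hγ : 0 < γ)
    (hγ1 : γ < 1) (π : Policy S A) (x : S × A) : occ P ν γ π x ≤ 1 := by
  simpa [truncOcc] using occ_le_truncOcc_add P ν hγ hγ1 0 π x

theorem measurable_trajProb (P : TransitionLaw S A) (n : ℕ) (ν : stdSimplex ℝ S)
    (τ : Fin n → S × A) : Measurable fun π : Policy S A => trajProb P π n ν τ := by
  induction n generalizing ν with
  | zero => simp only [trajProb]; fun_prop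
  | succ n ih =>
    simp only [trajProb]
    refine Measurable.mul (Measurable.mul measurable_const ?_) (ih _ _)
    exact (measurable_pi_apply _).comp (measurable_subtype_coe.comp (measurable_pi_apply _))

theorem measurable_visitProb (P : TransitionLaw S A) (ν : stdSimplex ℝ S) (t : ℕ) (x : S × A) :
    Measurable fun π : Policy S A => visitProb P ν π t x := by
  refine Finset.measurable_sum _ fun τ _ => ?_
  split_ifs
  · exact measurable_trajProb _ _ _ _
  · exact measurable_const

theorem measurable_occ (P : TransitionLaw S A) (ν : stdSimplex ℝ S) {γ : ℝ} (hγ : 0 < γ)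
    (hγ1 : γ < 1) (x : S × A) : Measurable fun π : Policy S A => occ P ν γ π x := by
  refine Measurable.const_mul ?_ _
  refine measurable_of_tendsto_metrizable (f := fun n (π : Policy S A) =>
    ∑ t ∈ Finset.range n, γ ^ t * visitProb P ν π t x) (fun n => ?_) ?_
  · exact Finset.measurable_sum _ fun t _ => (measurable_visitProb P ν t x).const_mul _
  · exact tendsto_pi_nhds.2 fun π =>
      (summable_visitProb P ν hγ hγ1 π x).hasSum.tendsto_sum_nat

/-! ### Empirical occupancy measures -/

/-- The discounted number of visits of a trajectory to `x`. -/
noncomputable def trajOcc {S A : Type*} [DecidableEq S] [DecidableEq A] {H : ℕ} (γ : ℝ)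
    (x : S × A) (τ : Fin H → S × A) : ℝ :=
  (1 - γ) * ∑ t : Fin H, γ ^ (t : ℕ) * if τ t = x then 1 else 0

theorem trajOcc_nonneg {H : ℕ} {γ : ℝ} (hγ : 0 < γ) (hγ1 : γ < 1) (x : S × A)
    (τ : Fin H → S × A) : 0 ≤ trajOcc γ x τ :=
  mul_nonneg (by linarith) (Finset.sum_nonneg fun t _ => by split_ifs <;> positivity)

theorem sum_trajOcc_le_one {H : ℕ} {γ : ℝ} (hγ : 0 < γ)
    (τ : Fin H → S × A) : ∑ x, trajOcc γ x τ ≤ 1 := by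
  simp only [trajOcc]
  rw [← Finset.mul_sum, Finset.sum_comm]
  simp only [← Finset.mul_sum, Finset.sum_ite_eq, Finset.mem_univ, if_true, mul_one]
  rw [Fin.sum_univ_eq_sum_range (fun t => γ ^ t), mul_neg_geom_sum]
  have : 0 < γ ^ H := by positivity
  linarith

theorem trajOcc_le_one {H : ℕ} {γ : ℝ} (hγ : 0 < γ) (hγ1 : γ < 1) (x : S × A)
    (τ : Fin H → S × A) : trajOcc γ x τ ≤ 1 :=
  (Finset.single_le_sum (f := fun x => trajOcc γ x τ) (fun x _ => trajOcc_nonneg hγ hγ1 x τ)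
    (Finset.mem_univ x)).trans (sum_trajOcc_le_one hγ τ)

/-- The empirical measure is unbiased for the truncated occupancy measure; the bias with respect to
`occ` is then only the truncation error. -/
theorem sum_trajProb_mul_trajOcc (P : TransitionLaw S A) (ν : stdSimplex ℝ S) (γ : ℝ) (H : ℕ)
    (π : Policy S A) (x : S × A) :
    ∑ τ : Fin H → S × A, trajProb P π H ν τ * trajOcc γ x τ = truncOcc P ν γ H π x := by
  simp only [trajOcc, truncOcc]
  rw [← Fin.sum_univ_eq_sum_range (fun t => γ ^ t * visitProb P ν π t x)]
  simp only [← marginal_eq_visitProb, marginal, Finset.mul_sum]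
  rw [Finset.sum_comm]
  refine Finset.sum_congr rfl fun t _ => Finset.sum_congr rfl fun τ _ => ?_
  split_ifs <;> ring

theorem empOcc_eq {N H : ℕ} (γ : ℝ) (D : Fin N → Fin H → S × A) (x : S × A) :
    empOcc γ D x = (N : ℝ)⁻¹ * ∑ i, trajOcc γ x (D i) := by
  simp only [empOcc, trajOcc, ← Finset.mul_sum]
  ring

theorem empOcc_nonneg {N H : ℕ} {γ : ℝ} (hγ : 0 < γ) (hγ1 : γ < 1) (D : Fin N → Fin H → S × A)
    (x : S × A) : 0 ≤ empOcc γ D x := by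
  rw [empOcc_eq]
  exact mul_nonneg (by positivity) (Finset.sum_nonneg fun i _ => trajOcc_nonneg hγ hγ1 _ _)

theorem sum_empOcc_le_one {N H : ℕ} {γ : ℝ} (hγ : 0 < γ)
    (D : Fin N → Fin H → S × A) : ∑ x, empOcc γ D x ≤ 1 := by
  simp only [empOcc_eq]
  rw [← Finset.mul_sum, Finset.sum_comm]
  have h := Finset.sum_le_sum fun i (_ : i ∈ Finset.univ) => sum_trajOcc_le_one hγ (D i)
  simp only [Finset.sum_const, Finset.card_univ, Fintype.card_fin, nsmul_eq_mul, mul_one] at h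
  calc _ ≤ (N : ℝ)⁻¹ * N := mul_le_mul_of_nonneg_left h (by positivity)
    _ ≤ 1 := inv_mul_le_one

/-! ### Concentration of data sets -/

theorem datasetLaw_apply {K : ℕ} (N H : ℕ) (P : Fin K → TransitionLaw S A) (ν₀ : stdSimplex ℝ S)
    (π : Fin K → Policy S A) (s : Set (Dataset K N H S A)) [DecidablePred (· ∈ s)] :
    datasetLaw N H P ν₀ π s = ENNReal.ofReal (∑ D : Dataset K N H S A,
      if D ∈ s then ∏ k, ∏ i, trajProb (P k) (π k) H ν₀ (D k i) else 0) := by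
  have h0 : ∀ D : Dataset K N H S A, 0 ≤ ∏ k, ∏ i, trajProb (P k) (π k) H ν₀ (D k i) :=
    fun D => Finset.prod_nonneg fun k _ => Finset.prod_nonneg fun i _ =>
      trajProb_nonneg _ _ _ _ _
  rw [ENNReal.ofReal_sum_of_nonneg fun D _ => by split_ifs <;> simp [h0]]
  simp only [datasetLaw, Measure.coe_finsetSum, Finset.sum_apply, Measure.smul_apply,
    smul_eq_mul]
  refine Finset.sum_congr rfl fun D _ => ?_
  rw [Measure.dirac_apply' _ (MeasurableSet.of_discrete)]
  by_cases h : D ∈ s <;> simp [h]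

/-- The data sets whose summed empirical occupancy measure is `η`-far from its target. -/
def deviating {K N H : ℕ} (P : Fin K → TransitionLaw S A) (ν₀ : stdSimplex ℝ S) (γ η : ℝ)
    (π : Fin K → Policy S A) : Set (Dataset K N H S A) :=
  {D | ∃ x, η < |∑ k, (empOcc γ (D k) x - occ (P k) ν₀ γ (π k) x)|}

/-- A union bound over the state-action pairs. Half of the threshold `2 * η` absorbs the truncation
bias of the `K` experts, the other half is left to Hoeffding. Keeping the sum over `k` inside the
absolute value lets the errors of different experts cancel, which yields `N / K` in the exponent. -/
theorem datasetLaw_deviating_le {K N H : ℕ} (hK : 0 < K) (hN : 0 < N)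
    (P : Fin K → TransitionLaw S A) (ν₀ : stdSimplex ℝ S) {γ : ℝ} (hγ : 0 < γ) (hγ1 : γ < 1)
    {η : ℝ} (hη : 0 ≤ η) (hH : K * γ ^ H ≤ η) (π : Fin K → Policy S A) :
    datasetLaw N H P ν₀ π (deviating P ν₀ γ (2 * η) π) ≤
      ENNReal.ofReal (2 * (Fintype.card S * Fintype.card A) *
        Real.exp (-(2 * η ^ 2 * N / K))) := by
  classical
  have hN' : (0 : ℝ) < N := by exact_mod_cast hN
  rw [datasetLaw_apply]
  refine ENNReal.ofReal_le_ofReal ?_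
  have h0 : ∀ D : Dataset K N H S A, 0 ≤ ∏ k, ∏ i, trajProb (P k) (π k) H ν₀ (D k i) :=
    fun D => Finset.prod_nonneg fun k _ => Finset.prod_nonneg fun i _ =>
      trajProb_nonneg _ _ _ _ _
  have key : ∀ (D : Dataset K N H S A) (x : S × A),
      2 * η < |∑ k, (empOcc γ (D k) x - occ (P k) ν₀ γ (π k) x)| →
      η * N ≤ |∑ k, ∑ i, (trajOcc γ x (D k i) -
        ∑ τ, trajProb (P k) (π k) H ν₀ τ * trajOcc γ x τ)| := by
    intro D x h
    simp only [sum_trajProb_mul_trajOcc]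
    -- Fluctuation around the truncated mean, minus the truncation bias.
    have e : ∑ k, (empOcc γ (D k) x - occ (P k) ν₀ γ (π k) x) =
        (N : ℝ)⁻¹ * (∑ k, ∑ i, (trajOcc γ x (D k i) - truncOcc (P k) ν₀ γ H (π k) x)) -
          ∑ k, (occ (P k) ν₀ γ (π k) x - truncOcc (P k) ν₀ γ H (π k) x) := by
      rw [Finset.mul_sum, ← Finset.sum_sub_distrib]
      refine Finset.sum_congr rfl fun k _ => ?_
      rw [empOcc_eq, Finset.sum_sub_distrib, mul_sub]
      simp only [Finset.sum_const, Finset.card_univ, Fintype.card_fin, nsmul_eq_mul]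
      field_simp
      ring
    set z := ∑ k, ∑ i, (trajOcc γ x (D k i) - truncOcc (P k) ν₀ γ H (π k) x)
    have b0 : 0 ≤ ∑ k, (occ (P k) ν₀ γ (π k) x - truncOcc (P k) ν₀ γ H (π k) x) :=
      Finset.sum_nonneg fun k _ => sub_nonneg.2 (truncOcc_le_occ _ _ hγ hγ1 _ _ _)
    have b1 : ∑ k, (occ (P k) ν₀ γ (π k) x - truncOcc (P k) ν₀ γ H (π k) x) ≤ K * γ ^ H := by
      calc _ ≤ ∑ _k : Fin K, γ ^ H := Finset.sum_le_sum fun k _ => by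
            linarith [occ_le_truncOcc_add (P k) ν₀ hγ hγ1 H (π k) x]
        _ = K * γ ^ H := by simp
    rw [e] at h
    have h2 := abs_sub ((N : ℝ)⁻¹ * z)
      (∑ k, (occ (P k) ν₀ γ (π k) x - truncOcc (P k) ν₀ γ H (π k) x))
    rw [abs_of_nonneg b0, abs_mul, abs_of_nonneg (by positivity : (0 : ℝ) ≤ (N : ℝ)⁻¹)] at h2
    have h3 : η ≤ (N : ℝ)⁻¹ * |z| := by linarith
    calc η * N ≤ (N : ℝ)⁻¹ * |z| * N := by gcongr
      _ = |z| := by field_simp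
  have hle : ∀ D : Dataset K N H S A, (if D ∈ deviating P ν₀ γ (2 * η) π then
      ∏ k, ∏ i, trajProb (P k) (π k) H ν₀ (D k i) else 0) ≤
      ∑ x : S × A, if η * N ≤ |∑ k, ∑ i, (trajOcc γ x (D k i) -
        ∑ τ, trajProb (P k) (π k) H ν₀ τ * trajOcc γ x τ)| then
          ∏ k, ∏ i, trajProb (P k) (π k) H ν₀ (D k i) else 0 := by
    intro D
    have hnn : ∀ x ∈ (Finset.univ : Finset (S × A)),
        0 ≤ if η * N ≤ |∑ k, ∑ i, (trajOcc γ x (D k i) -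
        ∑ τ, trajProb (P k) (π k) H ν₀ τ * trajOcc γ x τ)| then
          ∏ k, ∏ i, trajProb (P k) (π k) H ν₀ (D k i) else 0 := by
      intro x _; split_ifs; exacts [h0 D, le_rfl]
    split_ifs with h
    · obtain ⟨x, hx⟩ := h
      refine le_trans ?_ (Finset.single_le_sum hnn (Finset.mem_univ x))
      rw [if_pos (key D x hx)]
    · exact Finset.sum_nonneg hnn
  refine (Finset.sum_le_sum fun D _ => hle D).trans ?_
  rw [Finset.sum_comm]
  have hx : ∀ x : S × A, ∑ D : Dataset K N H S A, (if η * N ≤ |∑ k, ∑ i, (trajOcc γ x (D k i) -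
        ∑ τ, trajProb (P k) (π k) H ν₀ τ * trajOcc γ x τ)| then
          ∏ k, ∏ i, trajProb (P k) (π k) H ν₀ (D k i) else 0) ≤
      2 * Real.exp (-(2 * η ^ 2 * N / K)) := by
    intro x
    refine le_trans (le_of_eq ?_) (sum_prod_deviation_le (N := N) hK
      (fun k => trajProb (P k) (π k) H ν₀) (trajOcc γ x)
      (fun k => trajProb_nonneg _ _ _ _) (fun k => sum_trajProb _ _ _ _)
      (trajOcc_nonneg hγ hγ1 x) (trajOcc_le_one hγ hγ1 x) η hη)
    exact Fintype.sum_equiv (Equiv.refl _) _ _ fun _ => rfl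
  refine (Finset.sum_le_sum fun x _ => hx x).trans (le_of_eq ?_)
  simp only [Finset.sum_const, Finset.card_univ, Fintype.card_prod, nsmul_eq_mul]
  push_cast
  ring

end occupancy

/-! ### The suboptimality of an expert as a function of the reward -/

section suboptimality

variable {S A : Type*} [Fintype S] [Fintype A] [DecidableEq S] [DecidableEq A]

theorem objective_sub_objective (h : (A → ℝ) → ℝ) (r r' : Reward S A) (μ : S × A → ℝ) :
    objective h r μ - objective h r' μ = ∑ x, (r x - r' x) * μ x := by
  simp only [objective, sub_mul, Finset.sum_sub_distrib]
  ring

/-- The pairing is linear in the reward while the regularizer ignores it, so `c * J(r / c, μ)` is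
jointly linear in `(c, r)`. This is what makes the perspective subadditive. -/
theorem mul_objective_inv_smul (h : (A → ℝ) → ℝ) {c : ℝ} (hc : c ≠ 0) (r : Reward S A)
    (μ : S × A → ℝ) :
    c * objective h (c⁻¹ • r) μ = ∑ x, r x * μ x - c * occReg h μ := by
  simp only [objective, mul_sub, Finset.mul_sum, PiLp.smul_apply, smul_eq_mul]
  congr 1
  refine Finset.sum_congr rfl fun x _ => ?_
  field_simp

variable {P : TransitionLaw S A} {ν₀ : stdSimplex ℝ S} {γ : ℝ} {h : (A → ℝ) → ℝ}
  {rE : Reward S A} {μE : S × A → ℝ}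

theorem sum_mul_le_sum_abs (v : S × A → ℝ) {μ : S × A → ℝ} {c : ℝ} (hμ : ∀ x, |μ x| ≤ c) :
    ∑ x, v x * μ x ≤ c * ∑ x, |v x| := by
  rw [Finset.mul_sum]
  refine Finset.sum_le_sum fun x _ => ?_
  calc v x * μ x ≤ |v x * μ x| := le_abs_self _
    _ = |μ x| * |v x| := by rw [abs_mul, mul_comm]
    _ ≤ c * |v x| := mul_le_mul_of_nonneg_right (hμ x) (abs_nonneg _)

theorem occSet_mem_Icc (hγ : 0 < γ) (hγ1 : γ < 1) {μ : S × A → ℝ} (hμ : μ ∈ occSet P ν₀ γ)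
    (x : S × A) : 0 ≤ μ x ∧ μ x ≤ 1 := by
  obtain ⟨π, rfl⟩ := hμ
  exact ⟨occ_nonneg _ _ hγ hγ1 _ _, occ_le_one _ _ hγ hγ1 _ _⟩

/-- The expert's optimality bounds `J(rE, ·)`, and `J(r, ·)` differs from it by at most the `ℓ₁`
distance of the rewards, occupancy measures having entries in `[0, 1]`. -/
theorem bddAbove_objective (hγ : 0 < γ) (hγ1 : γ < 1) (hE : μE ∈ optimalOcc P ν₀ γ h rE)
    (r : Reward S A) : BddAbove (objective h r '' occSet P ν₀ γ) := by
  refine ⟨objective h rE μE + 1 * ∑ x, |r x - rE x|, ?_⟩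
  rintro _ ⟨μ, hμ, rfl⟩
  have h1 := objective_sub_objective h r rE μ
  have h2 := sum_mul_le_sum_abs (fun x => r x - rE x) (μ := μ) (c := 1) fun x => by
    have := occSet_mem_Icc hγ hγ1 hμ x
    rw [abs_of_nonneg this.1]; exact this.2
  have h3 := hE.2 μ hμ
  simp only at h2
  linarith

theorem objective_sub_le_subOpt (hγ : 0 < γ) (hγ1 : γ < 1) (hE : μE ∈ optimalOcc P ν₀ γ h rE)
    (r : Reward S A) (μ : S × A → ℝ) {μ' : S × A → ℝ} (hμ' : μ' ∈ occSet P ν₀ γ) :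
    objective h r μ' - objective h r μ ≤ subOpt P ν₀ γ h r μ :=
  sub_le_sub_right (le_csSup (bddAbove_objective hγ hγ1 hE r) ⟨μ', hμ', rfl⟩) _

theorem subOpt_le_of_forall (hE : μE ∈ optimalOcc P ν₀ γ h rE) (r : Reward S A)
    (μ : S × A → ℝ) {c : ℝ}
    (hc : ∀ μ' ∈ occSet P ν₀ γ, objective h r μ' - objective h r μ ≤ c) :
    subOpt P ν₀ γ h r μ ≤ c := by
  rw [subOpt, sub_le_iff_le_add]
  refine csSup_le ⟨_, μE, hE.1, rfl⟩ ?_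
  rintro _ ⟨μ', hμ', rfl⟩
  have := hc μ' hμ'
  linarith

theorem subOpt_nonneg (hγ : 0 < γ) (hγ1 : γ < 1) (hE : μE ∈ optimalOcc P ν₀ γ h rE)
    (r : Reward S A) {μ : S × A → ℝ} (hμ : μ ∈ occSet P ν₀ γ) : 0 ≤ subOpt P ν₀ γ h r μ := by
  simpa using objective_sub_le_subOpt hγ hγ1 hE r μ hμ

theorem abs_sub_le_one {a b : ℝ} (ha : 0 ≤ a ∧ a ≤ 1) (hb : 0 ≤ b ∧ b ≤ 1) : |a - b| ≤ 1 := by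
  rw [abs_le]; constructor <;> linarith [ha.1, ha.2, hb.1, hb.2]

theorem subOpt_expert_le_add (hγ : 0 < γ) (hγ1 : γ < 1) (hE : μE ∈ optimalOcc P ν₀ γ h rE)
    (r r' : Reward S A) :
    subOpt P ν₀ γ h r μE ≤ subOpt P ν₀ γ h r' μE + ∑ x, |r x - r' x| := by
  refine subOpt_le_of_forall hE r μE fun μ' hμ' => ?_
  have h1 := objective_sub_objective h r r' μ'
  have h2 := objective_sub_objective h r r' μE
  have h3 := sum_mul_le_sum_abs (fun x => r x - r' x) (μ := fun x => μ' x - μE x) (c := 1)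
    fun x => abs_sub_le_one (occSet_mem_Icc hγ hγ1 hμ' x) (occSet_mem_Icc hγ hγ1 hE.1 x)
  have h4 := objective_sub_le_subOpt hγ hγ1 hE r' μE hμ'
  simp only [mul_sub, Finset.sum_sub_distrib, one_mul] at h3
  linarith

theorem subOpt_expert_self_le (hE : μE ∈ optimalOcc P ν₀ γ h rE) :
    subOpt P ν₀ γ h rE μE ≤ 0 :=
  subOpt_le_of_forall hE _ _ fun μ' hμ' => by linarith [hE.2 μ' hμ']

theorem sum_abs_sub_le_two {r r' : Reward S A} (hr : r ∈ rewardClass S A)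
    (hr' : r' ∈ rewardClass S A) : ∑ x, |r x - r' x| ≤ 2 := by
  have h1 : ∑ x, |r x| ≤ 1 := hr
  have h2 : ∑ x, |r' x| ≤ 1 := hr'
  have h3 : ∑ x, |r x - r' x| ≤ ∑ x, (|r x| + |r' x|) :=
    Finset.sum_le_sum fun x _ => abs_sub _ _
  rw [Finset.sum_add_distrib] at h3
  linarith

theorem subOpt_expert_le_two (hγ : 0 < γ) (hγ1 : γ < 1) (hE : μE ∈ optimalOcc P ν₀ γ h rE)
    (hrE : rE ∈ rewardClass S A) {r : Reward S A} (hr : r ∈ rewardClass S A) :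
    subOpt P ν₀ γ h r μE ≤ 2 := by
  have h1 := subOpt_expert_le_add hγ hγ1 hE r rE
  have h2 := subOpt_expert_self_le hE
  have h3 := sum_abs_sub_le_two hr hrE
  linarith

/-- Follows from the `ℓ₁`-Lipschitz bound. It supplies the measurability of the potential and of the
success event. -/
theorem continuous_subOpt_expert (hγ : 0 < γ) (hγ1 : γ < 1)
    (hE : μE ∈ optimalOcc P ν₀ γ h rE) :
    Continuous fun r : Reward S A => subOpt P ν₀ γ h r μE := by
  rw [continuous_iff_continuousAt]
  intro r
  have hc : Continuous fun r' : Reward S A => ∑ x, |r' x - r x| := by fun_prop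
  have ht : Filter.Tendsto (fun r' : Reward S A => ∑ x, |r' x - r x|) (nhds r) (nhds 0) := by
    have := hc.tendsto r
    simpa using this
  rw [ContinuousAt, tendsto_iff_dist_tendsto_zero]
  refine squeeze_zero (fun _ => dist_nonneg) (fun r' => ?_) ht
  rw [Real.dist_eq, abs_le]
  have h1 := subOpt_expert_le_add hγ hγ1 hE r r'
  have h2 := subOpt_expert_le_add hγ hγ1 hE r' r
  simp only [abs_sub_comm (r _) _] at h1
  constructor <;> linarith

/-- The perspective of the suboptimality of an expert is subadditive. -/
theorem subOpt_expert_perspective (hγ : 0 < γ) (hγ1 : γ < 1)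
    (hE : μE ∈ optimalOcc P ν₀ γ h rE) {n : ℝ} (hn : 0 < n) (s r : Reward S A) :
    (n + 1) * subOpt P ν₀ γ h ((n + 1)⁻¹ • (s + r)) μE ≤
      n * subOpt P ν₀ γ h (n⁻¹ • s) μE + subOpt P ν₀ γ h r μE := by
  have hn1 : 0 < n + 1 := by linarith
  -- For a fixed `μ` the perspective is additive, since `n + 1` copies of the regularizer split as
  -- `n` and 1; taking suprema leaves an inequality.
  have e : ∀ μ, (n + 1) * objective h ((n + 1)⁻¹ • (s + r)) μ =
      n * objective h (n⁻¹ • s) μ + objective h r μ := by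
    intro μ
    rw [mul_objective_inv_smul h hn1.ne', mul_objective_inv_smul h hn.ne', objective]
    simp only [PiLp.add_apply, add_mul, Finset.sum_add_distrib]
    ring
  rw [mul_comm, ← le_div_iff₀ hn1]
  refine subOpt_le_of_forall hE _ _ fun μ' hμ' => ?_
  rw [le_div_iff₀ hn1, mul_comm, mul_sub, e, e]
  have h1 := objective_sub_le_subOpt hγ hγ1 hE (n⁻¹ • s) μE hμ'
  have h2 := objective_sub_le_subOpt hγ hγ1 hE r μE hμ'
  nlinarith

/-- The gap between an occupancy measure and that of the expert is an approximate subgradient. -/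
theorem subOpt_expert_le_subgradient (hE : μE ∈ optimalOcc P ν₀ γ h rE)
    (r : Reward S A) {μ : S × A → ℝ} (hμ : μ ∈ occSet P ν₀ γ) :
    subOpt P ν₀ γ h r μE ≤ subOpt P ν₀ γ h r μ + ∑ x, (r x - rE x) * (μ x - μE x) := by
  have h1 := objective_sub_objective h r rE μ
  have h2 := objective_sub_objective h r rE μE
  have h3 := hE.2 μ hμ
  simp only [mul_sub, Finset.sum_sub_distrib, subOpt]
  linarith

end suboptimality

/-! ### The projection onto the reward class -/

section projection

variable {S A : Type*} [Fintype S] [Fintype A]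

theorem proj_mem (y : Reward S A) : proj y ∈ rewardClass S A := (exists_proj y).choose_spec.1

theorem proj_eq_self {w : Reward S A} (hw : w ∈ rewardClass S A) : proj w = w := by
  have h1 : ‖w - proj w‖ = ⨅ v : rewardClass S A, ‖w - v‖ := (exists_proj w).choose_spec.2
  have h2 : ⨅ v : rewardClass S A, ‖w - v‖ ≤ ‖w - w‖ :=
    ciInf_le ⟨0, by rintro _ ⟨v, rfl⟩; exact norm_nonneg _⟩ (⟨w, hw⟩ : rewardClass S A)
  rw [sub_self, norm_zero, ← h1] at h2
  exact (sub_eq_zero.1 (norm_le_zero_iff.1 h2)).symm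

theorem norm_proj_sub_le (y : Reward S A) {w : Reward S A} (hw : w ∈ rewardClass S A) :
    ‖proj y - w‖ ≤ ‖y - w‖ := by
  have := proj_lipschitz.dist_le_mul y w
  rwa [proj_eq_self hw, dist_eq_norm, dist_eq_norm, NNReal.coe_one, one_mul] at this

/-- The projection is nonexpansive and fixes `w`, so it suffices to expand the square of the
unprojected step. -/
theorem norm_sq_proj_step_le (r g : Reward S A) (α : ℝ) {w : Reward S A}
    (hw : w ∈ rewardClass S A) :
    ‖proj (r - α • g) - w‖ ^ 2 ≤
      ‖r - w‖ ^ 2 - 2 * α * ∑ x, (r x - w x) * g x + α ^ 2 * ‖g‖ ^ 2 := by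
  have h1 := pow_le_pow_left₀ (norm_nonneg _) (norm_proj_sub_le (r - α • g) hw) 2
  have e : r - α • g - w = (r - w) - α • g := by abel
  have e2 : inner ℝ (r - w) g = ∑ x, (r x - w x) * g x := by
    simp [PiLp.inner_apply, mul_comm]
  rw [e, norm_sub_sq_real (r - w), inner_smul_right, norm_smul, mul_pow, e2, Real.norm_eq_abs,
    sq_abs] at h1
  linarith

theorem norm_le_sum_abs (v : Reward S A) : ‖v‖ ≤ ∑ x, |v x| := by
  rw [EuclideanSpace.norm_eq, Real.sqrt_le_left (Finset.sum_nonneg fun _ _ => abs_nonneg _)]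
  exact Finset.sum_sq_le_sq_sum_of_nonneg fun _ _ => abs_nonneg _

end projection

/-! ### The potential of the iteration -/

section potential

variable {S A : Type*} [Fintype S] [Fintype A] [DecidableEq S] [DecidableEq A] {K : ℕ}

/-- The sum of the suboptimalities of the experts. -/
noncomputable def totalSubOpt (P : Fin K → TransitionLaw S A) (ν₀ : stdSimplex ℝ S) (γ : ℝ)
    (h : (A → ℝ) → ℝ) (πE : Fin K → Policy S A) (r : Reward S A) : ℝ :=
  ∑ k, subOpt (P k) ν₀ γ h r (occ (P k) ν₀ γ (πE k))

/-- The potential of the state `x = (r, s)`, `s` being a sum of `n` rewards that ends with `r`. -/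
noncomputable def potential (P : Fin K → TransitionLaw S A) (ν₀ : stdSimplex ℝ S) (γ : ℝ)
    (h : (A → ℝ) → ℝ) (πE : Fin K → Policy S A) (rE : Reward S A) (α n : ℝ)
    (x : Reward S A × Reward S A) : ℝ :=
  n * totalSubOpt P ν₀ γ h πE (n⁻¹ • x.2) - totalSubOpt P ν₀ γ h πE x.1 +
    ‖x.1 - rE‖ ^ 2 / (2 * α)

variable {P : Fin K → TransitionLaw S A} {ν₀ : stdSimplex ℝ S} {γ : ℝ} {h : (A → ℝ) → ℝ}
  {rE : Reward S A} {πE : Fin K → Policy S A}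

theorem continuous_totalSubOpt (hγ : 0 < γ) (hγ1 : γ < 1)
    (hE : ∀ k, occ (P k) ν₀ γ (πE k) ∈ optimalOcc (P k) ν₀ γ h rE) :
    Continuous (totalSubOpt P ν₀ γ h πE) :=
  continuous_finsetSum _ fun k _ => continuous_subOpt_expert hγ hγ1 (hE k)

theorem continuous_potential (hγ : 0 < γ) (hγ1 : γ < 1)
    (hE : ∀ k, occ (P k) ν₀ γ (πE k) ∈ optimalOcc (P k) ν₀ γ h rE) (α n : ℝ) :
    Continuous (potential P ν₀ γ h πE rE α n) := by
  have h1 := continuous_totalSubOpt hγ hγ1 hE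
  have h2 : Continuous fun x : Reward S A × Reward S A =>
      totalSubOpt P ν₀ γ h πE (n⁻¹ • x.2) := h1.comp (by fun_prop)
  have h3 : Continuous fun x : Reward S A × Reward S A => totalSubOpt P ν₀ γ h πE x.1 :=
    h1.comp continuous_fst
  have h4 : Continuous fun x : Reward S A × Reward S A => ‖x.1 - rE‖ ^ 2 / (2 * α) := by
    fun_prop
  exact ((h2.const_mul n).sub h3).add h4

theorem subOpt_le_totalSubOpt (hγ : 0 < γ) (hγ1 : γ < 1)
    (hE : ∀ k, occ (P k) ν₀ γ (πE k) ∈ optimalOcc (P k) ν₀ γ h rE) (r : Reward S A) (k : Fin K) :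
    subOpt (P k) ν₀ γ h r (occ (P k) ν₀ γ (πE k)) ≤ totalSubOpt P ν₀ γ h πE r :=
  Finset.single_le_sum (f := fun k => subOpt (P k) ν₀ γ h r (occ (P k) ν₀ γ (πE k)))
    (fun k _ => subOpt_nonneg hγ hγ1 (hE k) r (hE k).1) (Finset.mem_univ k)

theorem totalSubOpt_le (hγ : 0 < γ) (hγ1 : γ < 1)
    (hE : ∀ k, occ (P k) ν₀ γ (πE k) ∈ optimalOcc (P k) ν₀ γ h rE)
    (hrE : rE ∈ rewardClass S A) {r : Reward S A} (hr : r ∈ rewardClass S A) :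
    totalSubOpt P ν₀ γ h πE r ≤ 2 * K := by
  calc _ ≤ ∑ _k : Fin K, (2 : ℝ) :=
        Finset.sum_le_sum fun k _ => subOpt_expert_le_two hγ hγ1 (hE k) hrE hr
    _ = 2 * K := by simp [mul_comm]

theorem totalSubOpt_perspective (hγ : 0 < γ) (hγ1 : γ < 1)
    (hE : ∀ k, occ (P k) ν₀ γ (πE k) ∈ optimalOcc (P k) ν₀ γ h rE) {n : ℝ} (hn : 0 < n)
    (s r : Reward S A) :
    (n + 1) * totalSubOpt P ν₀ γ h πE ((n + 1)⁻¹ • (s + r)) ≤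
      n * totalSubOpt P ν₀ γ h πE (n⁻¹ • s) + totalSubOpt P ν₀ γ h πE r := by
  simp only [totalSubOpt, Finset.mul_sum]
  rw [← Finset.sum_add_distrib]
  exact Finset.sum_le_sum fun k _ => subOpt_expert_perspective hγ hγ1 (hE k) hn s r

variable {N H NE HE : ℕ}

theorem sum_abs_gradient_le (hγ : 0 < γ) (hγ1 : γ < 1) (D : Dataset K N H S A)
    (DE : Dataset K NE HE S A) : ∑ x, |gradient γ D DE x| ≤ 2 * K := by
  have h1 : ∀ x, |gradient γ D DE x| ≤ ∑ k, (empOcc γ (D k) x + empOcc γ (DE k) x) := by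
    intro x
    change |∑ k, (empOcc γ (D k) x - empOcc γ (DE k) x)| ≤ _
    refine (Finset.abs_sum_le_sum_abs _ _).trans (Finset.sum_le_sum fun k _ => ?_)
    refine (abs_sub _ _).trans ?_
    rw [abs_of_nonneg (empOcc_nonneg hγ hγ1 _ _), abs_of_nonneg (empOcc_nonneg hγ hγ1 _ _)]
  refine (Finset.sum_le_sum fun x _ => h1 x).trans ?_
  rw [Finset.sum_comm]
  calc _ ≤ ∑ _k : Fin K, (2 : ℝ) := Finset.sum_le_sum fun k _ => by
        rw [Finset.sum_add_distrib]
        linarith [sum_empOcc_le_one hγ (D k), sum_empOcc_le_one hγ (DE k)]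
    _ = 2 * K := by simp [mul_comm]

/-- In the potential the value of `F` at the last reward is subtracted, so each reward is charged
only when the step from it is made. Convexity replaces the new average by the old one plus the new
reward, whose `F` cancels; the distance term supplies `-⟨r - rE, g⟩`, and `‖g‖ ≤ 2K` turns `α ‖g‖² /
2` into `2 K² α`. -/
theorem potential_update_le (hγ : 0 < γ) (hγ1 : γ < 1)
    (hE : ∀ k, occ (P k) ν₀ γ (πE k) ∈ optimalOcc (P k) ν₀ γ h rE)
    (hrE : rE ∈ rewardClass S A) {α n : ℝ} (hα : 0 < α) (hn : 0 < n)
    (x : Reward S A × Reward S A) (D : Dataset K N H S A) (DE : Dataset K NE HE S A) :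
    potential P ν₀ γ h πE rE α (n + 1) (update γ α DE (x, D)) ≤
      potential P ν₀ γ h πE rE α n x + 2 * K ^ 2 * α +
        (totalSubOpt P ν₀ γ h πE x.1 - ∑ y, (x.1 y - rE y) * gradient γ D DE y) := by
  set g := gradient γ D DE with hg
  have h1 := totalSubOpt_perspective hγ hγ1 hE hn x.2 (proj (x.1 - α • g))
  have h2 := norm_sq_proj_step_le x.1 g α hrE
  have h3 : ‖g‖ ≤ 2 * K := (norm_le_sum_abs g).trans (sum_abs_gradient_le hγ hγ1 D DE)
  have h4 := pow_le_pow_left₀ (norm_nonneg _) h3 2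
  have h5 : ‖proj (x.1 - α • g) - rE‖ ^ 2 / (2 * α) ≤
      ‖x.1 - rE‖ ^ 2 / (2 * α) - ∑ y, (x.1 y - rE y) * g y + 2 * K ^ 2 * α := by
    rw [div_le_iff₀ (by positivity)]
    have e : (‖x.1 - rE‖ ^ 2 / (2 * α) - ∑ y, (x.1 y - rE y) * g y + 2 * K ^ 2 * α) * (2 * α) =
        ‖x.1 - rE‖ ^ 2 - 2 * α * ∑ y, (x.1 y - rE y) * g y + α ^ 2 * (2 * K) ^ 2 := by
      field_simp
    rw [e]
    nlinarith [sq_nonneg α]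
  simp only [potential, update, ← hg]
  linarith

/-- The price of a failed iteration: `2K` from the suboptimalities and `2 · 2K` from pairing `r -
rE`, of `ℓ₁` norm at most 2, with the gradient. -/
theorem totalSubOpt_sub_inner_gradient_le (hγ : 0 < γ) (hγ1 : γ < 1)
    (hE : ∀ k, occ (P k) ν₀ γ (πE k) ∈ optimalOcc (P k) ν₀ γ h rE)
    (hrE : rE ∈ rewardClass S A) {r : Reward S A} (hr : r ∈ rewardClass S A)
    (D : Dataset K N H S A) (DE : Dataset K NE HE S A) :
    totalSubOpt P ν₀ γ h πE r - ∑ y, (r y - rE y) * gradient γ D DE y ≤ 6 * K := by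
  have h1 := totalSubOpt_le hγ hγ1 hE hrE hr
  have h2 := sum_abs_gradient_le hγ hγ1 D DE
  have h3 := sum_mul_le_sum_abs (fun y => -(r y - rE y)) (μ := gradient γ D DE) (c := 2 * K)
    fun x => (Finset.single_le_sum (f := fun x => |gradient γ D DE x|)
      (fun x _ => abs_nonneg _) (Finset.mem_univ x)).trans h2
  have h4 := sum_abs_sub_le_two hr hrE
  simp only [abs_neg, neg_mul, Finset.sum_neg_distrib] at h3
  have h5 : (0 : ℝ) ≤ K := by positivity
  nlinarith

/-- The oracles contribute `K * e`; the rollouts and the expert data contribute `2 * η` each, as `r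
- rE` has `ℓ₁` norm at most 2. -/
theorem totalSubOpt_sub_inner_gradient_le_of_good
    (hE : ∀ k, occ (P k) ν₀ γ (πE k) ∈ optimalOcc (P k) ν₀ γ h rE)
    (hrE : rE ∈ rewardClass S A) {r : Reward S A} (hr : r ∈ rewardClass S A)
    {π : Fin K → Policy S A} {e η : ℝ}
    (hπ : ∀ k, subOpt (P k) ν₀ γ h r (occ (P k) ν₀ γ (π k)) ≤ e)
    {D : Dataset K N H S A} (hD : D ∉ deviating P ν₀ γ η π)
    {DE : Dataset K NE HE S A} (hDE : DE ∉ deviating P ν₀ γ η πE) (hη : 0 ≤ η) :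
    totalSubOpt P ν₀ γ h πE r - ∑ y, (r y - rE y) * gradient γ D DE y ≤ K * e + 4 * η := by
  simp only [deviating, Set.mem_ofPred_eq, not_exists, not_lt] at hD hDE
  have h0 := sum_abs_sub_le_two hr hrE
  have h1 : totalSubOpt P ν₀ γ h πE r ≤ ∑ k, (e + ∑ x, (r x - rE x) *
      (occ (P k) ν₀ γ (π k) x - occ (P k) ν₀ γ (πE k) x)) :=
    Finset.sum_le_sum fun k _ => (subOpt_expert_le_subgradient (hE k) r ⟨π k, rfl⟩).trans
      (by linarith [hπ k])
  rw [Finset.sum_add_distrib, Finset.sum_comm] at h1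
  simp only [← Finset.mul_sum, Finset.sum_const, Finset.card_univ, Fintype.card_fin,
    nsmul_eq_mul] at h1
  have h2 := sum_mul_le_sum_abs (fun y => -(r y - rE y)) hD
  have h3 := sum_mul_le_sum_abs (fun y => r y - rE y) hDE
  simp only [abs_neg, neg_mul, Finset.sum_neg_distrib] at h2 h3
  have e1 : ∑ y, (r y - rE y) * gradient γ D DE y =
      ∑ y, (r y - rE y) * (∑ k, (empOcc γ (D k) y - occ (P k) ν₀ γ (π k) y)) +
      ∑ y, (r y - rE y) * (∑ k, (occ (P k) ν₀ γ (π k) y - occ (P k) ν₀ γ (πE k) y)) -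
      ∑ y, (r y - rE y) * (∑ k, (empOcc γ (DE k) y - occ (P k) ν₀ γ (πE k) y)) := by
    rw [← Finset.sum_add_distrib, ← Finset.sum_sub_distrib]
    refine Finset.sum_congr rfl fun y _ => ?_
    rw [← mul_add, ← mul_sub]
    simp only [gradient, Finset.sum_sub_distrib]
    ring
  rw [e1]
  nlinarith

end potential

/-! ### Failures of the oracles -/

section oracle

variable {S A : Type*} [Fintype S] [Fintype A] [DecidableEq S] [DecidableEq A]

theorem policyOf_mem_stdSimplex [Nonempty A] {μ : S × A → ℝ} (hμ : ∀ x, 0 ≤ μ x) (s : S) :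
    policyOf μ s ∈ stdSimplex ℝ A := by
  constructor
  · intro a
    unfold policyOf
    split_ifs with h
    · exact div_nonneg (hμ _) h.le
    · positivity
  · unfold policyOf
    split_ifs with h
    · rw [← Finset.sum_div, div_self h.ne']
    · simp

theorem measurable_objective_occ [Nonempty A] (P : TransitionLaw S A) (ν₀ : stdSimplex ℝ S)
    {γ : ℝ} (hγ : 0 < γ) (hγ1 : γ < 1) {h : (A → ℝ) → ℝ}
    (hh : Measurable fun p : stdSimplex ℝ A => h p) (r : Reward S A) :
    Measurable fun π : Policy S A => objective h r (occ P ν₀ γ π) := by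
  have hocc := measurable_occ P ν₀ hγ hγ1
  have hpol : ∀ s, Measurable fun π : Policy S A => h (policyOf (occ P ν₀ γ π) s) := by
    intro s
    -- Measurability of `h` is available only on the simplex, so the induced policy is first lifted
    -- to it.
    have hm : Measurable fun π : Policy S A => (⟨policyOf (occ P ν₀ γ π) s,
        policyOf_mem_stdSimplex (occ_nonneg P ν₀ hγ hγ1 π) s⟩ : stdSimplex ℝ A) := by
      refine Measurable.subtype_mk (measurable_pi_iff.2 fun a => ?_)
      have hsum : Measurable fun π : Policy S A => ∑ b, occ P ν₀ γ π (s, b) :=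
        Finset.measurable_sum _ fun b _ => hocc (s, b)
      exact Measurable.ite (measurableSet_lt measurable_const hsum)
        ((hocc (s, a)).div hsum) measurable_const
    exact hh.comp hm
  exact (Finset.measurable_sum _ fun x _ => (hocc x).const_mul _).sub
    (Finset.measurable_sum _ fun x _ => (hocc x).mul (hpol x.1))

/-- The policies that are not `e`-optimal for `r`. -/
def failing (P : TransitionLaw S A) (ν₀ : stdSimplex ℝ S) (γ : ℝ) (h : (A → ℝ) → ℝ) (e : ℝ)
    (r : Reward S A) : Set (Policy S A) :=
  {π | e < subOpt P ν₀ γ h r (occ P ν₀ γ π)}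

theorem measurableSet_failing [Nonempty A] (P : TransitionLaw S A) (ν₀ : stdSimplex ℝ S)
    {γ : ℝ} (hγ : 0 < γ) (hγ1 : γ < 1) {h : (A → ℝ) → ℝ}
    (hh : Measurable fun p : stdSimplex ℝ A => h p) (e : ℝ) (r : Reward S A) :
    MeasurableSet (failing P ν₀ γ h e r) :=
  measurableSet_lt measurable_const
    ((measurable_objective_occ P ν₀ hγ hγ1 hh r).const_sub _)

theorem IsPACOracle.failing_le [Nonempty A] {P : TransitionLaw S A} {ν₀ : stdSimplex ℝ S}
    {γ : ℝ} (hγ : 0 < γ) (hγ1 : γ < 1) {h : (A → ℝ) → ℝ}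
    (hh : Measurable fun p : stdSimplex ℝ A => h p) {ε δ ε' δ' : ℝ}
    {oracle : Kernel (Reward S A) (Policy S A)} [IsMarkovKernel oracle]
    (ho : IsPACOracle P ν₀ γ h ε δ oracle) (hε : ε ≤ ε') (hδ : δ ≤ δ') {r : Reward S A}
    (hr : r ∈ rewardClass S A) :
    oracle r (failing P ν₀ γ h ε' r) ≤ ENNReal.ofReal δ' := by
  have hm := measurableSet_failing P ν₀ hγ hγ1 hh ε' r
  have h1 : 1 - δ ≤ (oracle r).real (failing P ν₀ γ h ε' r)ᶜ := by
    refine (ho r hr).trans (measureReal_mono fun π hπ => ?_)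
    exact not_lt.2 (le_trans hπ hε)
  rw [probReal_compl_eq_one_sub hm] at h1
  rw [← ofReal_measureReal]
  exact ENNReal.ofReal_le_ofReal (by linarith)

end oracle

/-! ### The law of one iteration -/

section iteration

variable {S A : Type*} [Fintype S] [Fintype A] [DecidableEq S] [DecidableEq A]
  {K N H NE HE : ℕ} {P : Fin K → TransitionLaw S A} {ν₀ : stdSimplex ℝ S} {γ : ℝ}
  {h : (A → ℝ) → ℝ} {rE : Reward S A} {πE : Fin K → Policy S A}
  {oracle : Fin K → Kernel (Reward S A) (Policy S A)} [∀ k, IsMarkovKernel (oracle k)]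

theorem measurable_update_left (γ α : ℝ) (DE : Dataset K NE HE S A)
    (x : Reward S A × Reward S A) :
    Measurable fun D : Dataset K N H S A => update γ α DE (x, D) := Measurable.of_discrete

theorem iteration_apply (α : ℝ) (DE : Dataset K NE HE S A) (x : Reward S A × Reward S A) :
    iteration N H P ν₀ γ oracle α DE x =
      ((rollout N H P ν₀ ∘ₖ callOracles oracle) x.1).map fun D => update γ α DE (x, D) := by
  rw [iteration, Kernel.map_apply _ (measurable_update γ α DE), Kernel.prod_apply,
    Kernel.id_apply, Kernel.comap_apply, Measure.dirac_prod,
    Measure.map_map (measurable_update γ α DE) (by fun_prop)]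
  rfl

theorem lintegral_iteration (α : ℝ) (DE : Dataset K NE HE S A) (x : Reward S A × Reward S A)
    {W : Reward S A × Reward S A → ENNReal} (hW : Measurable W) :
    ∫⁻ y, W y ∂(iteration N H P ν₀ γ oracle α DE x) =
      ∫⁻ π, ∫⁻ D, W (update γ α DE (x, D)) ∂(datasetLaw N H P ν₀ π)
        ∂(Measure.pi fun k => oracle k x.1) := by
  rw [iteration_apply, lintegral_map hW (measurable_update_left γ α DE x),
    Kernel.lintegral_comp _ _ _ Measurable.of_discrete]
  rfl

/-- The state with index `t` carries a sum of `t + 1` rewards, each in the class by projection. -/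
theorem ae_runLaw_mem_rewardClass (α : ℝ) {r₀ : Reward S A} (hr₀ : r₀ ∈ rewardClass S A)
    (DE : Dataset K NE HE S A) (t : ℕ) :
    ∀ᵐ x ∂(runLaw N H P ν₀ γ oracle α r₀ DE t),
      x.1 ∈ rewardClass S A ∧ ∑ y, |x.2 y| ≤ (t : ℝ) + 1 := by
  have hB : ∀ t : ℕ, MeasurableSet {x : Reward S A × Reward S A |
      x.1 ∈ rewardClass S A ∧ ∑ y, |x.2 y| ≤ (t : ℝ) + 1} := by
    intro t
    have hc : Continuous fun x : Reward S A × Reward S A => ∑ y, |x.2 y| := by fun_prop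
    exact (measurable_fst (rewardClass_isClosed S A).measurableSet).inter
      (measurableSet_le hc.measurable measurable_const)
  induction t with
  | zero =>
    have h0 : ∑ y, |r₀ y| ≤ 1 := hr₀
    rw [runLaw, ae_dirac_iff (hB 0)]
    exact ⟨hr₀, by simpa using h0⟩
  | succ t ih =>
    have hstep : ∀ᵐ x ∂(runLaw N H P ν₀ γ oracle α r₀ DE t),
        iteration N H P ν₀ γ oracle α DE x {x : Reward S A × Reward S A |
          x.1 ∈ rewardClass S A ∧ ∑ y, |x.2 y| ≤ ((t + 1 : ℕ) : ℝ) + 1}ᶜ = 0 := by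
      filter_upwards [ih] with x hx
      rw [iteration_apply, Measure.map_apply (measurable_update_left γ α DE x) (hB _).compl]
      refine measure_mono_null (fun D hD => ?_) measure_empty
      refine hD ⟨proj_mem _, ?_⟩
      have h1 : ∑ y, |proj (x.1 - α • gradient γ D DE) y| ≤ 1 := proj_mem _
      have h2 : ∑ y, |(x.2 + proj (x.1 - α • gradient γ D DE)) y| ≤
          ∑ y, (|x.2 y| + |proj (x.1 - α • gradient γ D DE) y|) :=
        Finset.sum_le_sum fun y _ => abs_add_le _ _
      rw [Finset.sum_add_distrib] at h2
      change ∑ y, |(x.2 + proj (x.1 - α • gradient γ D DE)) y| ≤ _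
      push_cast
      linarith [hx.2]
    rw [ae_iff, runLaw, ← Set.compl_ofPred, Measure.bind_apply (hB _).compl
      (Kernel.aemeasurable _)]
    exact (lintegral_congr_ae hstep).trans lintegral_zero

/-- The excess of the potential over its bound in the absence of failures. -/
noncomputable def excess (P : Fin K → TransitionLaw S A) (ν₀ : stdSimplex ℝ S) (γ : ℝ)
    (h : (A → ℝ) → ℝ) (πE : Fin K → Policy S A) (rE : Reward S A) (α c : ℝ) (t : ℕ)
    (x : Reward S A × Reward S A) : ENNReal :=
  ENNReal.ofReal (potential P ν₀ γ h πE rE α (t + 1) x - c * t - 2 / α)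

theorem measurable_excess (hγ : 0 < γ) (hγ1 : γ < 1)
    (hE : ∀ k, occ (P k) ν₀ γ (πE k) ∈ optimalOcc (P k) ν₀ γ h rE) (α c : ℝ) (t : ℕ) :
    Measurable (excess P ν₀ γ h πE rE α c t) :=
  ((((continuous_potential hγ hγ1 hE α (t + 1)).measurable.sub_const _).sub_const _)).ennreal_ofReal

/-- The increment allowed without failure is exactly what the excess subtracts per iteration, so
only failures increase it. The indicators charge `6K` for every failing oracle and for deviating
rollouts. -/
theorem excess_update_le (hγ : 0 < γ) (hγ1 : γ < 1)
    (hE : ∀ k, occ (P k) ν₀ γ (πE k) ∈ optimalOcc (P k) ν₀ γ h rE)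
    (hrE : rE ∈ rewardClass S A) {α e η : ℝ} (hα : 0 < α) (he : 0 ≤ e) (hη : 0 ≤ η)
    {x : Reward S A × Reward S A} (hx : x.1 ∈ rewardClass S A) (π : Fin K → Policy S A)
    (D : Dataset K N H S A) {DE : Dataset K NE HE S A} (hDE : DE ∉ deviating P ν₀ γ η πE)
    (t : ℕ) :
    excess P ν₀ γ h πE rE α (2 * K ^ 2 * α + K * e + 4 * η) (t + 1) (update γ α DE (x, D)) ≤
      excess P ν₀ γ h πE rE α (2 * K ^ 2 * α + K * e + 4 * η) t x +
      ∑ k, (failing (P k) ν₀ γ h e x.1).indicator (fun _ => ENNReal.ofReal (6 * K)) (π k) +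
      (deviating P ν₀ γ η π).indicator (fun _ => ENNReal.ofReal (6 * K)) D := by
  have h1 := potential_update_le hγ hγ1 hE hrE hα (by positivity : (0 : ℝ) < t + 1) x D DE
  have hb := totalSubOpt_sub_inner_gradient_le hγ hγ1 hE hrE hx D DE
  have hK : (0 : ℝ) ≤ K := by positivity
  have hKe : 0 ≤ K * e := by positivity
  have hbad : excess P ν₀ γ h πE rE α (2 * K ^ 2 * α + K * e + 4 * η) (t + 1)
      (update γ α DE (x, D)) ≤
      excess P ν₀ γ h πE rE α (2 * K ^ 2 * α + K * e + 4 * η) t x + ENNReal.ofReal (6 * K) := by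
    refine le_trans ?_ ENNReal.ofReal_add_le
    refine ENNReal.ofReal_le_ofReal ?_
    push_cast
    linarith
  by_cases hF : ∃ k, π k ∈ failing (P k) ν₀ γ h e x.1
  · obtain ⟨k, hk⟩ := hF
    refine hbad.trans (le_trans (add_le_add_right ?_ _) le_self_add)
    refine le_trans (le_of_eq ?_) (Finset.single_le_sum (fun _ _ => zero_le) (Finset.mem_univ k))
    rw [Set.indicator_of_mem hk]
  · by_cases hD : D ∈ deviating P ν₀ γ η π
    · rw [Set.indicator_of_mem hD]
      exact hbad.trans (add_le_add_left le_self_add _)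
    · refine le_trans ?_ (le_self_add.trans le_self_add)
      simp only [failing, Set.mem_ofPred_eq, not_exists, not_lt] at hF
      have hg := totalSubOpt_sub_inner_gradient_le_of_good hE hrE hx hF hD hDE hη
      refine ENNReal.ofReal_le_ofReal ?_
      push_cast
      linarith

/-- Integrating the indicators costs `p` for the rollouts, conditionally on the policies, and `d`
for each oracle, whose law is a marginal of the product measure. -/
theorem lintegral_excess_iteration_le [Nonempty A] (hγ : 0 < γ) (hγ1 : γ < 1)
    (hh : Measurable fun p : stdSimplex ℝ A => h p)
    (hE : ∀ k, occ (P k) ν₀ γ (πE k) ∈ optimalOcc (P k) ν₀ γ h rE)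
    (hrE : rE ∈ rewardClass S A) {α e η : ℝ} (hα : 0 < α) (he : 0 ≤ e) (hη : 0 ≤ η)
    {d p : ENNReal}
    (hd : ∀ k, ∀ r ∈ rewardClass S A, oracle k r (failing (P k) ν₀ γ h e r) ≤ d)
    (hp : ∀ π, datasetLaw N H P ν₀ π (deviating P ν₀ γ η π) ≤ p)
    {x : Reward S A × Reward S A} (hx : x.1 ∈ rewardClass S A)
    {DE : Dataset K NE HE S A} (hDE : DE ∉ deviating P ν₀ γ η πE) (t : ℕ) :
    ∫⁻ y, excess P ν₀ γ h πE rE α (2 * K ^ 2 * α + K * e + 4 * η) (t + 1) y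
        ∂(iteration N H P ν₀ γ oracle α DE x) ≤
      excess P ν₀ γ h πE rE α (2 * K ^ 2 * α + K * e + 4 * η) t x +
        ENNReal.ofReal (6 * K) * (K * d + p) := by
  rw [lintegral_iteration α DE x (measurable_excess hγ hγ1 hE _ _ _)]
  set W := excess P ν₀ γ h πE rE α (2 * K ^ 2 * α + K * e + 4 * η) t x
  set M := ENNReal.ofReal (6 * K)
  have hF := fun k => measurableSet_failing (P k) ν₀ hγ hγ1 hh e x.1
  have hFm : ∀ k, Measurable fun π : Fin K → Policy S A =>
      (failing (P k) ν₀ γ h e x.1).indicator (fun _ => M) (π k) := fun k =>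
    (measurable_const.indicator (hF k)).comp (measurable_pi_apply k)
  have inner : ∀ π : Fin K → Policy S A,
      ∫⁻ D, excess P ν₀ γ h πE rE α (2 * K ^ 2 * α + K * e + 4 * η) (t + 1)
        (update γ α DE (x, D)) ∂(datasetLaw N H P ν₀ π) ≤
      (∑ k, (failing (P k) ν₀ γ h e x.1).indicator (fun _ => M) (π k)) + (W + M * p) := by
    intro π
    refine (lintegral_mono fun D => excess_update_le hγ hγ1 hE hrE hα he hη hx π D hDE t).trans ?_
    rw [lintegral_add_left measurable_const, lintegral_const, measure_univ, mul_one,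
      lintegral_indicator_const (MeasurableSet.of_discrete), add_comm W, add_assoc]
    gcongr
    exact hp π
  refine (lintegral_mono inner).trans ?_
  rw [lintegral_add_right _ measurable_const, lintegral_const, measure_univ, mul_one,
    lintegral_finsetSum _ fun k _ => hFm k]
  have hk : ∀ k, ∫⁻ π, (failing (P k) ν₀ γ h e x.1).indicator (fun _ => M) (π k)
      ∂(Measure.pi fun k => oracle k x.1) ≤ M * d := by
    intro k
    rw [(measurePreserving_eval (fun k => oracle k x.1) k).lintegral_comp
      (measurable_const.indicator (hF k)), lintegral_indicator_const (hF k)]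
    gcongr
    exact hd k _ hx
  calc _ ≤ (∑ _k : Fin K, M * d) + (W + M * p) := by gcongr; exact hk _
    _ = W + M * (K * d + p) := by
      rw [Finset.sum_const, Finset.card_univ, Fintype.card_fin, nsmul_eq_mul]
      ring

theorem lintegral_excess_runLaw_le [Nonempty A] (hγ : 0 < γ) (hγ1 : γ < 1)
    (hh : Measurable fun p : stdSimplex ℝ A => h p)
    (hE : ∀ k, occ (P k) ν₀ γ (πE k) ∈ optimalOcc (P k) ν₀ γ h rE)
    (hrE : rE ∈ rewardClass S A) {α e η : ℝ} (hα : 0 < α) (he : 0 ≤ e) (hη : 0 ≤ η)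
    {d p : ENNReal}
    (hd : ∀ k, ∀ r ∈ rewardClass S A, oracle k r (failing (P k) ν₀ γ h e r) ≤ d)
    (hp : ∀ π, datasetLaw N H P ν₀ π (deviating P ν₀ γ η π) ≤ p)
    {r₀ : Reward S A} (hr₀ : r₀ ∈ rewardClass S A)
    {DE : Dataset K NE HE S A} (hDE : DE ∉ deviating P ν₀ γ η πE) (t : ℕ) :
    ∫⁻ y, excess P ν₀ γ h πE rE α (2 * K ^ 2 * α + K * e + 4 * η) t y
        ∂(runLaw N H P ν₀ γ oracle α r₀ DE t) ≤
      t * (ENNReal.ofReal (6 * K) * (K * d + p)) := by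
  induction t with
  | zero =>
    -- Initially the two values of `F` cancel, and the distance term is at most `2 / α` because `‖r₀
    -- - rE‖ ≤ 2`; the excess vanishes.
    rw [runLaw, lintegral_dirac' _ (measurable_excess hγ hγ1 hE _ _ _), excess, potential]
    simp only [Nat.cast_zero, zero_mul, nonpos_iff_eq_zero, ENNReal.ofReal_eq_zero]
    have h1 : ‖r₀ - rE‖ ≤ 2 := (norm_le_sum_abs _).trans (sum_abs_sub_le_two hr₀ hrE)
    have h2 := pow_le_pow_left₀ (norm_nonneg _) h1 2
    have h3 : ‖r₀ - rE‖ ^ 2 / (2 * α) ≤ 2 / α := by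
      rw [div_le_div_iff₀ (by positivity) hα]
      nlinarith
    norm_num
    linarith
  | succ t ih =>
    rw [runLaw, Measure.lintegral_bind (Kernel.aemeasurable _)
      (measurable_excess hγ hγ1 hE _ _ _).aemeasurable]
    have := isProbabilityMeasure_runLaw N H P ν₀ γ oracle α r₀ DE t
    have hstep : ∀ᵐ x ∂(runLaw N H P ν₀ γ oracle α r₀ DE t),
        ∫⁻ y, excess P ν₀ γ h πE rE α (2 * K ^ 2 * α + K * e + 4 * η) (t + 1) y
          ∂(iteration N H P ν₀ γ oracle α DE x) ≤
        excess P ν₀ γ h πE rE α (2 * K ^ 2 * α + K * e + 4 * η) t x +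
          ENNReal.ofReal (6 * K) * (K * d + p) := by
      filter_upwards [ae_runLaw_mem_rewardClass α hr₀ DE t] with x hx
      exact lintegral_excess_iteration_le hγ hγ1 hh hE hrE hα he hη hd hp hx.1 hDE t
    refine (lintegral_mono_ae hstep).trans ?_
    rw [lintegral_add_right _ measurable_const, lintegral_const, measure_univ, mul_one]
    push_cast
    rw [add_mul, one_mul]
    gcongr

theorem totalSubOpt_average_le (hγ : 0 < γ) (hγ1 : γ < 1)
    (hE : ∀ k, occ (P k) ν₀ γ (πE k) ∈ optimalOcc (P k) ν₀ γ h rE)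
    (hrE : rE ∈ rewardClass S A) {α c a : ℝ} (hα : 0 < α) {t : ℕ}
    {x : Reward S A × Reward S A} (hx : x.1 ∈ rewardClass S A)
    (hW : excess P ν₀ γ h πE rE α c t x < ENNReal.ofReal a) :
    (t + 1) * totalSubOpt P ν₀ γ h πE (((t : ℝ) + 1)⁻¹ • x.2) ≤
      a + c * t + 2 / α + 2 * K := by
  have h1 : potential P ν₀ γ h πE rE α (t + 1) x - c * t - 2 / α < a := by
    by_contra hlt
    exact (not_lt.2 (ENNReal.ofReal_le_ofReal (not_lt.1 hlt))) hW
  have h2 := totalSubOpt_le hγ hγ1 hE hrE hx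
  have h3 : 0 ≤ ‖x.1 - rE‖ ^ 2 / (2 * α) := by positivity
  rw [potential] at h1
  linarith

/-- Markov's inequality for the excess at level `a`. The summand `2 * K` restores the value of `F`
at the last reward, which the potential had subtracted. -/
theorem runLaw_totalSubOpt_average_le [Nonempty A] (hγ : 0 < γ) (hγ1 : γ < 1)
    (hh : Measurable fun p : stdSimplex ℝ A => h p)
    (hE : ∀ k, occ (P k) ν₀ γ (πE k) ∈ optimalOcc (P k) ν₀ γ h rE)
    (hrE : rE ∈ rewardClass S A) {α e η a : ℝ} (hα : 0 < α) (he : 0 ≤ e) (hη : 0 ≤ η)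
    (ha : 0 < a) {d p : ℝ} (hd0 : 0 ≤ d) (hp0 : 0 ≤ p)
    (hd : ∀ k, ∀ r ∈ rewardClass S A,
      oracle k r (failing (P k) ν₀ γ h e r) ≤ ENNReal.ofReal d)
    (hp : ∀ π, datasetLaw N H P ν₀ π (deviating P ν₀ γ η π) ≤ ENNReal.ofReal p)
    {r₀ : Reward S A} (hr₀ : r₀ ∈ rewardClass S A)
    {DE : Dataset K NE HE S A} (hDE : DE ∉ deviating P ν₀ γ η πE) (t : ℕ) :
    runLaw N H P ν₀ γ oracle α r₀ DE t {x | ¬ (t + 1) *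
      totalSubOpt P ν₀ γ h πE (((t : ℝ) + 1)⁻¹ • x.2) ≤
        a + (2 * K ^ 2 * α + K * e + 4 * η) * t + 2 / α + 2 * K} ≤
      ENNReal.ofReal (t * (6 * K * (K * d + p)) / a) := by
  have h1 := lintegral_excess_runLaw_le hγ hγ1 hh hE hrE hα he hη hd hp hr₀ hDE t
  have h2 := meas_ge_le_lintegral_div (μ := runLaw N H P ν₀ γ oracle α r₀ DE t)
    (measurable_excess hγ hγ1 hE α (2 * K ^ 2 * α + K * e + 4 * η) t).aemeasurable
    (ε := ENNReal.ofReal a) (by simpa using ha) (by simp)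
  refine (measure_mono_ae ?_).trans (h2.trans ?_)
  · filter_upwards [ae_runLaw_mem_rewardClass α hr₀ DE t] with x hx hbad
    exact not_lt.1 fun hlt => hbad (totalSubOpt_average_le hγ hγ1 hE hrE hα hx.1 hlt)
  · refine (ENNReal.div_le_div_right h1 _).trans (le_of_eq ?_)
    have hK : (0 : ℝ) ≤ K := by positivity
    have ht : (0 : ℝ) ≤ t := by positivity
    rw [ENNReal.ofReal_div_of_pos ha, ENNReal.ofReal_mul ht,
      ENNReal.ofReal_mul (show 0 ≤ 6 * (K : ℝ) by positivity),
      ENNReal.ofReal_add (by positivity) hp0, ENNReal.ofReal_mul hK, ENNReal.ofReal_natCast,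
      ENNReal.ofReal_natCast]

end iteration

/-! ### The parameters -/

/-- With `η = ε / 32` the constant 8192 makes the Hoeffding exponent at least `16 * log Y`. -/
theorem exp_neg_mul_sq_le {K ε N Y : ℝ} (hK : 0 < K) (hε : 0 < ε) (hY : 0 < Y)
    (hN : 8192 * (K * Real.log Y / ε ^ 2) ≤ N) :
    Real.exp (-(2 * (ε / 32) ^ 2 * N / K)) ≤ Y⁻¹ ^ 16 := by
  rw [← Real.exp_log (show 0 < Y⁻¹ ^ 16 by positivity), Real.exp_le_exp, Real.log_pow,
    Real.log_inv]
  have h1 : 2 * (ε / 32) ^ 2 * (8192 * (K * Real.log Y / ε ^ 2)) / K = 16 * Real.log Y := by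
    field_simp
    ring
  have h2 : 2 * (ε / 32) ^ 2 * (8192 * (K * Real.log Y / ε ^ 2)) / K ≤
      2 * (ε / 32) ^ 2 * N / K := by gcongr
  push_cast
  linarith

/-- One of the sixteen powers absorbs the union bound over `n` pairs; the other fifteen are at most
`1 / 2` each. -/
theorem two_mul_mul_pow_le {n z c : ℝ} (hn : 0 ≤ n) (hz : 0 ≤ z) (hz1 : z ≤ 1 / 2)
    (hc : n * z ≤ c) : 2 * n * z ^ 16 ≤ c / 16384 := by
  have h1 := pow_le_pow_left₀ hz hz1 15
  have h2 : 0 ≤ n * z := by positivity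
  calc 2 * n * z ^ 16 = 2 * (n * z) * z ^ 15 := by ring
    _ ≤ 2 * (n * z) * (1 / 2) ^ 15 := by gcongr
    _ ≤ 2 * c * (1 / 2) ^ 15 := by gcongr
    _ = c / 16384 := by ring

theorem mul_pow_horizon_le {K ε γ : ℝ} {H : ℕ} (hK : 1 ≤ K) (hε : 0 < ε) (hε2 : ε < 2)
    (hγ : 0 < γ) (hγ1 : γ < 1)
    (hH : 8192 * (Real.log (16 * K / ε) / Real.log (1 / γ)) ≤ H) :
    K * γ ^ H ≤ ε / 32 := by
  have hlog : 0 < Real.log (1 / γ) := Real.log_pos (by rw [lt_div_iff₀ hγ]; linarith)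
  have hY : 8 ≤ 16 * K / ε := by rw [le_div_iff₀ hε]; linarith
  have hlY : 0 ≤ Real.log (16 * K / ε) := Real.log_nonneg (by linarith)
  have h1 : 8192 * Real.log (16 * K / ε) ≤ H * Real.log (1 / γ) := by
    rw [← mul_div_assoc, div_le_iff₀ hlog] at hH
    exact hH
  -- Of the 8192 available powers two suffice: one cancels `K`, the other is at most `1 / 8`.
  have h2 : γ ^ H ≤ (16 * K / ε)⁻¹ ^ 2 := by
    rw [← Real.log_le_log_iff (by positivity) (by positivity), Real.log_pow, Real.log_pow,
      Real.log_inv]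
    rw [one_div, Real.log_inv] at h1
    push_cast
    linarith
  have h3 : (16 * K / ε)⁻¹ ≤ 8⁻¹ := inv_anti₀ (by norm_num) hY
  have h4 : (16 * K / ε)⁻¹ = ε / (16 * K) := inv_div _ _
  have h5 : 0 < ε / (16 * K) := by positivity
  rw [h4] at h2 h3
  calc K * γ ^ H ≤ K * (ε / (16 * K)) ^ 2 := by gcongr
    _ = K * (ε / (16 * K)) * (ε / (16 * K)) := by ring
    _ ≤ K * (ε / (16 * K)) * 8⁻¹ := by gcongr
    _ = ε / 128 := by field_simp; norm_num
    _ ≤ ε / 32 := by linarith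

/-- As fractions of `ε T`: `1/4` for the Markov level, `1/32 + 1/8192 + 1/4` for step size, oracles
and sampling, `1/32` for the initial distance and `1/32` for the last reward. -/
theorem regret_budget_le {K ε T : ℝ} (hK : 1 ≤ K) (hε : 0 < ε) (hT1 : 1 ≤ T)
    (hT : 8192 * (K ^ 2 / ε ^ 2) ≤ T) :
    ε * T / 4 + (2 * K ^ 2 * (1 / (K * √T)) + K * (ε / (8192 * K)) + 4 * (2 * (ε / 32))) * (T - 1)
      + 2 / (1 / (K * √T)) + 2 * K ≤ T * ε := by
  have hK0 : 0 < K := by linarith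
  have hs0 : 0 < √T := Real.sqrt_pos.2 (by linarith)
  have hss : √T * √T = T := Real.mul_self_sqrt (by linarith)
  have hs1 : 1 ≤ √T := Real.one_le_sqrt.2 hT1
  -- All that is used of the lower bound on `T`; possible since `64² ≤ 8192`.
  have hK64 : 64 * K ≤ √T * ε := by
    refine abs_le_of_sq_le_sq' ?_ (by positivity) |>.2
    rw [← mul_div_assoc, div_le_iff₀ (by positivity)] at hT
    nlinarith
  have e1 : 2 * K ^ 2 * (1 / (K * √T)) + K * (ε / (8192 * K)) + 4 * (2 * (ε / 32)) =
      2 * K / √T + ε / 8192 + ε / 4 := by field_simp; ring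
  have e2 : 2 / (1 / (K * √T)) = 2 * K * √T := by field_simp
  have h1 : 2 * K / √T + ε / 8192 + ε / 4 ≤ ε / 32 + ε / 8192 + ε / 4 := by
    have : 2 * K / √T ≤ ε / 32 := by
      rw [div_le_iff₀ hs0]
      linarith
    linarith
  rw [e1, e2]
  have h2 : (2 * K / √T + ε / 8192 + ε / 4) * (T - 1) ≤ (ε / 32 + ε / 8192 + ε / 4) * T :=
    mul_le_mul h1 (by linarith) (by linarith) (by positivity)
  have h3 : 2 * K * √T ≤ ε * T / 32 := by nlinarith
  have h4 : 2 * K ≤ ε * T / 32 := by nlinarith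
  nlinarith [mul_pos hε (by linarith : 0 < T)]

/-- The Markov level `ε * T / 4` cancels the number of iterations, so the expected cost of one
iteration only has to be at most `δ * ε / 8`. -/
theorem failure_budget_le {K ε δ p T : ℝ} (hK : 1 ≤ K) (hε : 0 < ε) (hε2 : ε < 2) (hδ : 0 < δ)
    (hT1 : 1 ≤ T) (hp0 : 0 ≤ p) (hp : p ≤ δ * ε / K / 16384) :
    (T - 1) * (6 * K * (K * (δ * ε ^ 2 / (8192 * K ^ 3)) + p)) / (ε * T / 4) ≤ δ / 2 := by
  have hK0 : 0 < K := by linarith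
  have e1 : 6 * K * (K * (δ * ε ^ 2 / (8192 * K ^ 3)) + p) ≤ δ * ε / 8 := by
    have h1 : 6 * K * (δ * ε / K / 16384) = 6 * (δ * ε) / 16384 := by field_simp
    have h2 : 6 * K * (K * (δ * ε ^ 2 / (8192 * K ^ 3))) = 6 * (δ * ε) * ε / (8192 * K) := by
      field_simp
    have h3 : 6 * (δ * ε) * ε / (8192 * K) ≤ 6 * (δ * ε) * 2 / (8192 * 1) := by gcongr
    have h4 : 6 * K * p ≤ 6 * K * (δ * ε / K / 16384) := by gcongr
    have h5 : 0 < δ * ε := by positivity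
    rw [mul_add, h2]
    linarith
  have e0 : 0 ≤ 6 * K * (K * (δ * ε ^ 2 / (8192 * K ^ 3)) + p) := by positivity
  rw [div_le_iff₀ (by positivity)]
  calc _ ≤ T * (δ * ε / 8) := mul_le_mul (by linarith) e1 e0 (by linarith)
    _ = δ / 2 * (ε * T / 4) := by ring

/-! ### The law of the output -/

section output

variable {S A : Type*} [Fintype S] [Fintype A] [DecidableEq S] [DecidableEq A]
  {K N H NE HE : ℕ} {P : Fin K → TransitionLaw S A} {ν₀ : stdSimplex ℝ S} {γ : ℝ}
  {h : (A → ℝ) → ℝ} {rE : Reward S A} {πE : Fin K → Policy S A}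
  {oracle : Fin K → Kernel (Reward S A) (Policy S A)} [∀ k, IsMarkovKernel (oracle k)]

theorem isClosed_forall_subOpt_le (hγ : 0 < γ) (hγ1 : γ < 1)
    (hE : ∀ k, occ (P k) ν₀ γ (πE k) ∈ optimalOcc (P k) ν₀ γ h rE) (ε : ℝ) :
    IsClosed {r : Reward S A | ∀ k, subOpt (P k) ν₀ γ h r (occ (P k) ν₀ γ (πE k)) ≤ ε} := by
  rw [Set.ofPred_forall]
  exact isClosed_iInter fun k =>
    isClosed_le (continuous_subOpt_expert hγ hγ1 (hE k)) continuous_const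

/-- A bound on the failure probability for all expert data outside of `B`. -/
theorem outputLaw_compl_le {T : ℕ} {α : ℝ} {r₀ : Reward S A} {G : Set (Reward S A)}
    (hG : MeasurableSet G) (B : Set (Dataset K NE H S A)) {q : ENNReal}
    (hB : ∀ DE ∉ B, runLaw N H P ν₀ γ oracle α r₀ DE (T - 1) {x | (T : ℝ)⁻¹ • x.2 ∉ G} ≤ q) :
    outputLaw P ν₀ γ πE NE H oracle N H T α r₀ Gᶜ ≤ datasetLaw NE H P ν₀ πE B + q := by
  rw [outputLaw, Measure.bind_apply hG.compl (Measurable.of_discrete).aemeasurable]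
  have hle : ∀ DE : Dataset K NE H S A,
      (runLaw N H P ν₀ γ oracle α r₀ DE (T - 1)).map (fun x => (T : ℝ)⁻¹ • x.2) Gᶜ ≤
        B.indicator (fun _ => 1) DE + q := by
    intro DE
    have := isProbabilityMeasure_runLaw N H P ν₀ γ oracle α r₀ DE (T - 1)
    rw [Measure.map_apply (by fun_prop) hG.compl]
    by_cases hDE : DE ∈ B
    · rw [Set.indicator_of_mem hDE]
      exact prob_le_one.trans le_self_add
    · exact (hB DE hDE).trans le_add_self
  refine (lintegral_mono hle).trans ?_
  rw [lintegral_add_right _ measurable_const, lintegral_const, measure_univ, mul_one,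
    lintegral_indicator_const (MeasurableSet.of_discrete), one_mul]

theorem one_sub_le_outputLaw {T : ℕ} {α δ : ℝ} {r₀ : Reward S A} {G : Set (Reward S A)}
    (hδ : 0 ≤ δ) (hG : MeasurableSet G)
    (h : outputLaw P ν₀ γ πE NE H oracle N H T α r₀ Gᶜ ≤ ENNReal.ofReal δ) :
    1 - δ ≤ (outputLaw P ν₀ γ πE NE H oracle N H T α r₀).real G := by
  have := isProbabilityMeasure_outputLaw P ν₀ γ πE NE H oracle N H T α r₀
  have h1 := ENNReal.toReal_mono ENNReal.ofReal_ne_top h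
  rw [ENNReal.toReal_ofReal hδ] at h1
  have h2 := probReal_compl_eq_one_sub (μ := outputLaw P ν₀ γ πE NE H oracle N H T α r₀) hG
  rw [Measure.real] at h2
  linarith

theorem inv_smul_mem_rewardClass {T : ℝ} (hT : 0 < T) {s : Reward S A} (hs : ∑ y, |s y| ≤ T) :
    T⁻¹ • s ∈ rewardClass S A := by
  change ∑ y, |(T⁻¹ • s) y| ≤ 1
  simp only [PiLp.smul_apply, smul_eq_mul, abs_mul, ← Finset.mul_sum,
    abs_of_nonneg (inv_nonneg.2 hT.le)]
  rw [inv_mul_le_iff₀ hT, mul_one]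
  exact hs

end output

end MultiExpertIRL

/-! ### Choice of the parameters and conclusion -/

open MultiExpertIRL in
theorem theorem3 :
    ∃ C : ℝ, 0 < C ∧
      ∀ (S A : Type*) [Fintype S] [Fintype A] [DecidableEq S] [DecidableEq A]
        [Nontrivial S] [Nontrivial A]
        -- the number of experts, their environments and the regularizer
        (K : ℕ) (_ : 1 ≤ K) (P : Fin K → TransitionLaw S A) (ν₀ : stdSimplex ℝ S)
        (γ : ℝ) (_ : 0 < γ) (_ : γ < 1)
        (X : Set (A → ℝ)) (h : (A → ℝ) → ℝ) (_ : IsRegularizer X h)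
        -- the experts, all optimal for the same reward of the reward class
        (rE : Reward S A) (_ : rE ∈ rewardClass S A) (πE : Fin K → Policy S A)
        (_ : ∀ k, occ (P k) ν₀ γ (πE k) ∈ optimalOcc (P k) ν₀ γ h rE)
        -- the target accuracy and confidence
        (ε δ : ℝ) (_ : 0 < ε) (_ : 0 < δ) (_ : δ < 1)
        -- the forward oracles
        (εopt δopt : ℝ) (oracle : Fin K → Kernel (Reward S A) (Policy S A))
        [∀ k, IsMarkovKernel (oracle k)]
        (_ : ∀ k, IsPACOracle (P k) ν₀ γ h εopt δopt (oracle k))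
        (_ : εopt ≤ ε / (C * K)) (_ : δopt ≤ δ * ε ^ 2 / (C * K ^ 3))
        -- the numbers of trajectories, the horizon, the number of iterations, the initial reward
        (NE N H T : ℕ)
        (_ : C * (K * Real.log (Fintype.card S * Fintype.card A / δ) / ε ^ 2) ≤ NE)
        (_ : C * (K * Real.log (K * Fintype.card S * Fintype.card A / (δ * ε)) / ε ^ 2) ≤ N)
        (_ : C * (Real.log (16 * K / ε) / Real.log (1 / γ)) ≤ H)
        (_ : C * (K ^ 2 / ε ^ 2) ≤ T)
        (r₀ : Reward S A) (_ : r₀ ∈ rewardClass S A),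
        1 - δ ≤ (outputLaw P ν₀ γ πE NE H oracle N H T (1 / (K * √T)) r₀).real
          {r | ∀ k, subOpt (P k) ν₀ γ h r (occ (P k) ν₀ γ (πE k)) ≤ ε} := by
  refine ⟨8192, by norm_num, ?_⟩
  intro S A _ _ _ _ _ _ K hK P ν₀ γ hγ hγ1 X h hreg rE hrE πE hE ε δ hε hδ hδ1 εopt δopt oracle _
    hpac hεopt hδopt NE N H T hNE hN hH hT r₀ hr₀
  have hK1 : (1 : ℝ) ≤ K := by exact_mod_cast hK
  have hK0 : (0 : ℝ) < K := by linarith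
  have hT0 : (0 : ℝ) < T := lt_of_lt_of_le (by positivity) hT
  obtain ⟨t, rfl⟩ : ∃ t, T = t + 1 :=
    Nat.exists_eq_succ_of_ne_zero (by rintro rfl; simp at hT0)
  have hT1 : (1 : ℝ) ≤ ((t + 1 : ℕ) : ℝ) := by push_cast; linarith [Nat.cast_nonneg (α := ℝ) t]
  have hG := (isClosed_forall_subOpt_le hγ hγ1 hE ε).measurableSet
  refine one_sub_le_outputLaw hδ.le hG ?_
  -- For `ε ≥ 2` every reward of the class succeeds, and the average lies in the class almost
  -- surely. Below 2, the logarithms have arguments at least 2, as the tail bounds require.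
  rcases le_or_gt 2 ε with hε2 | hε2
  · refine (outputLaw_compl_le hG ∅ (q := 0) fun DE _ => ?_).trans (by simp)
    rw [Nat.add_sub_cancel]
    refine (measure_mono_null ?_ (ae_iff.1
      (ae_runLaw_mem_rewardClass (1 / (K * √((t + 1 : ℕ) : ℝ))) hr₀ DE t))).le
    intro x hx hmem
    refine hx fun k => (subOpt_expert_le_two hγ hγ1 (hE k) hrE ?_).trans hε2
    exact inv_smul_mem_rewardClass hT0 (by push_cast; exact hmem.2)
  set n : ℝ := (Fintype.card S : ℝ) * Fintype.card A with hn
  have hn4 : 4 ≤ n := by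
    have h1 : (2 : ℝ) ≤ Fintype.card S := by exact_mod_cast Fintype.one_lt_card (α := S)
    have h2 : (2 : ℝ) ≤ Fintype.card A := by exact_mod_cast Fintype.one_lt_card (α := A)
    nlinarith
  have hn0 : 0 < n := by linarith
  rw [mul_assoc (K : ℝ), ← hn] at hN
  have hpos : ∀ {Y : ℝ} {m : ℕ}, 2 ≤ Y → 8192 * (K * Real.log Y / ε ^ 2) ≤ (m : ℝ) → 0 < m := by
    intro Y m hY hm
    have : 0 < Real.log Y := Real.log_pos (by linarith)
    exact_mod_cast lt_of_lt_of_le (by positivity : 0 < 8192 * (K * Real.log Y / ε ^ 2)) hm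
  -- Used with `Y = n / δ`, `c = δ` for the experts and with `Y = K n / (δ ε)`, `c = δ ε / K` for
  -- the rollouts.
  have hdev : ∀ {Y c : ℝ} {m : ℕ} (π : Fin K → Policy S A), 2 ≤ Y → n * Y⁻¹ ≤ c →
      8192 * (K * Real.log Y / ε ^ 2) ≤ (m : ℝ) →
      datasetLaw m H P ν₀ π (deviating P ν₀ γ (2 * (ε / 32)) π) ≤
        ENNReal.ofReal (c / 16384) := by
    intro Y c m π hY hc hm
    refine (datasetLaw_deviating_le hK (hpos hY hm) P ν₀ hγ hγ1 (by positivity)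
      (mul_pow_horizon_le hK1 hε hε2 hγ hγ1 hH) π).trans (ENNReal.ofReal_le_ofReal ?_)
    rw [← hn]
    have hY0 : 0 < Y := by linarith
    refine le_trans ?_ (two_mul_mul_pow_le hn0.le (inv_nonneg.2 hY0.le) ?_ hc)
    · gcongr
      exact exp_neg_mul_sq_le hK0 hε hY0 hm
    · rw [one_div]
      exact inv_anti₀ (by norm_num) hY
  have hYE : 2 ≤ n / δ := by rw [le_div_iff₀ hδ]; linarith
  have hY : 2 ≤ K * n / (δ * ε) := by
    rw [le_div_iff₀ (by positivity)]
    nlinarith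
  have hexp : datasetLaw NE H P ν₀ πE (deviating P ν₀ γ (2 * (ε / 32)) πE) ≤
      ENNReal.ofReal (δ / 2) :=
    (hdev πE hYE (c := δ) (le_of_eq (by field_simp)) hNE).trans
      (ENNReal.ofReal_le_ofReal (by linarith))
  have hroll : ∀ π, datasetLaw N H P ν₀ π (deviating P ν₀ γ (2 * (ε / 32)) π) ≤
      ENNReal.ofReal (δ * ε / K / 16384) := fun π =>
    hdev π hY (le_of_eq (by field_simp)) hN
  have hsum : ENNReal.ofReal (δ / 2) + ENNReal.ofReal (δ / 2) = ENNReal.ofReal δ := by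
    rw [← ENNReal.ofReal_add (by linarith) (by linarith), add_halves]
  rw [← hsum]
  -- Half of `δ` pays for bad expert data, the other half for a bad run on good expert data.
  refine (outputLaw_compl_le hG (deviating P ν₀ γ (2 * (ε / 32)) πE)
    (q := ENNReal.ofReal (δ / 2)) fun DE hDE => ?_).trans (add_le_add_left hexp _)
  rw [Nat.add_sub_cancel]
  have hα : 0 < 1 / (K * √((t + 1 : ℕ) : ℝ)) := by positivity
  have hmain := runLaw_totalSubOpt_average_le (a := ε * ((t + 1 : ℕ) : ℝ) / 4) hγ hγ1
    hreg.measurable hE hrE hα (e := ε / (8192 * K)) (by positivity)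
    (by positivity : 0 ≤ 2 * (ε / 32)) (by positivity) (d := δ * ε ^ 2 / (8192 * K ^ 3))
    (by positivity) (p := δ * ε / K / 16384) (by positivity)
    (fun k r hr => (hpac k).failing_le hγ hγ1 hreg.measurable hεopt hδopt hr) hroll hr₀ hDE t
  have ht : (t : ℝ) = ((t + 1 : ℕ) : ℝ) - 1 := by push_cast; ring
  refine (measure_mono ?_).trans (hmain.trans (ENNReal.ofReal_le_ofReal ?_))
  · intro x hx hgood
    refine hx fun k => (subOpt_le_totalSubOpt hγ hγ1 hE _ k).trans ?_
    have hb := regret_budget_le hK1 hε hT1 hT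
    rw [← ht] at hb
    have h1 := hgood.trans hb
    rw [← Nat.cast_succ] at h1
    exact le_of_mul_le_mul_left h1 hT0
  · rw [ht]
    exact failure_budget_le hK1 hε hε2 hδ hT1 (by positivity) le_rfl
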